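/- For $d\in\mathbb N$ let $\mathrm{Pol}(O_d^+)$ be the universal unital $*$-algebra generated by self-adjoint elements $u_{ij}$, $1\le i,j\le d$, such that $u=(u_{ij})$ satisfies $uu^{\top}=u^{\top}u=1$, and let $\mathrm{Pol}(H_d^+)$ be its quotient by the additional relations $u_{ij}^3=u_{ij}$ for all $i,j$ and $u_{ij}u_{ij'}=0=u_{ji}u_{j'i}$ for all $i$ and all $j\neq j'$. A (closed) quantum subset $\mathbb X\subset O_d^+$ is given by a unital $*$-algebra $\mathrm{Pol}(\mathbb X)$ which admits a faithful $*$-representation by bounded operators on a Hilbert space, together with a surjective unital $*$-homomorphism $\beta\colon\mathrm{Pol}(O_d^+)\to\mathrm{Pol}(\mathbb X)$; put $\dot u_{ij}=\beta(u_{ij})$. One writes $\mathbb X\subset H_d^+$ if $\beta$ factors through the canonical map $\mathrm{Pol}(O_d^+)\to\mathrm{Pol}(H_d^+)$. Let $(\mathcal A,\varphi)$ be a non-commutative probability space, i.e. $\mathcal A$ is a unital complex $*$-algebra and $\varphi\colon\mathcal A\to\mathbb C$ is linear with $\varphi(1)=1$ and $\varphi(aa^*)\ge 0$ for all $a\in\mathcal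 A$. Let $E=\varphi\otimes\mathrm{id}\colon\mathcal A\otimes\mathrm{Pol}(\mathbb X)\to\mathrm{Pol}(\mathbb X)$ (algebraic tensor product). Elements $Y_1,\dots,Y_d\in\mathcal A\otimes\mathrm{Pol}(\mathbb X)$ are free with amalgamation over $\mathrm{Pol}(\mathbb X)$ if $E(a_1\cdots a_n)=0$ whenever $n\ge1$, $a_k$ lies in the subalgebra generated by $1\otimes\mathrm{Pol}(\mathbb X)$ and $Y_{j_k}$, $E(a_k)=0$ for all $k$, and $j_k\ne j_{k+1}$ for all $k<n$. Free cumulants $\kappa_n$ are defined by $\varphi(a_1\cdots a_n)=\sum_{\pi\in NC(n)}\prod_{V\in\pi}\kappa_{|V|}(a_i:i\in V)$. **Theorem.** Let $X_1,\dots,X_d\in\mathcal A$ be self-adjoint, free with respect to $\varphi$ and identically distributed (that is, $\varphi(X_i^n)=\varphi(X_{i'}^n)$ for all $i,i',n$), and let $\mathbb X\subset O_d^+$ be a quantum subset with $\mathbb X\not\subset H_d^+$. Suppose that the rotated variables $Y_j=\sum_{i=1}^d X_i\otimes\dot u_{ij}$, $1\le j\le d$, are free with amalgamation over $\mathrm{Pol}(\mathbb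 X)$ with respect to $E$. Then $X_1,\dots,X_d$ form a semicircular system: there are $m\in\mathbb R$ and $\sigma\ge0$ such that every $X_i$ has the semicircular distribution with mean $m$ and variance $\sigma^2$, i.e. $\varphi(X_i^n)=\int t^n\,d\mu(t)$ for all $n\ge 1$, where $\mu$ is the image of the law $\frac1{2\pi}\sqrt{4-x^2}\,\mathbf 1_{[-2,2]}(x)\,dx$ under $x\mapsto m+\sigma x$ (a point mass if $\sigma=0$); and all free cumulants of order at least three vanish: $\kappa_n(X_{i_1},\dots,X_{i_n})=0$ for all $n\ge3$ and all $i_1,\dots,i_n\in\{1,\dots,d\}$. -/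

import Mathlib

open scoped TensorProduct NNReal ComplexOrder

noncomputable section

/-! ### Unital `*`-algebras presented by self-adjoint generators and relations -/

/-- The free unital complex `*`-algebra on self-adjoint generators indexed by `X`:
complex combinations of words, with `star (c • w) = conj c • reverse w`. -/
def FreeSAAlg (X : Type*) : Type _ := MonoidAlgebra ℂ (FreeMonoid X)

namespace FreeSAAlg

variable {X : Type*}

instance : Ring (FreeSAAlg X) := inferInstanceAs (Ring (MonoidAlgebra ℂ (FreeMonoid X)))

instance : Algebra ℂ (FreeSAAlg X) :=
  inferInstanceAs (Algebra ℂ (MonoidAlgebra ℂ (FreeMonoid X)))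

/-- The self-adjoint generators. -/
def gen (x : X) : FreeSAAlg X := MonoidAlgebra.of ℂ (FreeMonoid X) (FreeMonoid.of x)

theorem induction {p : FreeSAAlg X → Prop}
    (scalar : ∀ c : ℂ, p (algebraMap ℂ _ c)) (gen : ∀ x, p (gen x))
    (mul : ∀ a b, p a → p b → p (a * b)) (add : ∀ a b, p a → p b → p (a + b))
    (a : FreeSAAlg X) : p a := by
  have key : ∀ w : FreeMonoid X, p (MonoidAlgebra.of ℂ (FreeMonoid X) w) := by
    intro w
    induction w using FreeMonoid.inductionOn' with
    | one =>
      have h := scalar 1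
      rw [map_one] at h
      rw [map_one]
      exact h
    | of_mul x w ih =>
      rw [map_mul]
      exact mul _ _ (gen x) ih
  refine MonoidAlgebra.induction_on (motive := p) a key add ?_
  intro c f hf
  rw [Algebra.smul_def]
  exact mul _ _ (scalar c) hf

/-- Evaluation of noncommutative polynomials. -/
def eval {B : Type*} [Ring B] [Algebra ℂ B] (f : X → B) : FreeSAAlg X →ₐ[ℂ] B :=
  MonoidAlgebra.lift ℂ B (FreeMonoid X) (FreeMonoid.lift f)

@[simp] theorem eval_gen {B : Type*} [Ring B] [Algebra ℂ B] (f : X → B) (x : X) :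
    eval f (gen x) = f x := by
  show MonoidAlgebra.lift ℂ B (FreeMonoid X) (FreeMonoid.lift f)
    (MonoidAlgebra.of ℂ (FreeMonoid X) (FreeMonoid.of x)) = f x
  simp

/-- The involution, as a ring homomorphism to the opposite ring. -/
def starHom : FreeSAAlg X →+* (FreeSAAlg X)ᵐᵒᵖ :=
  MonoidAlgebra.liftNCRingHom
    ((algebraMap ℂ (FreeSAAlg X)ᵐᵒᵖ).comp (starRingEnd ℂ))
    (FreeMonoid.lift fun x => MulOpposite.op (gen x))
    fun c _ => Algebra.commutes (starRingEnd ℂ c) _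

theorem starHom_algebraMap (c : ℂ) :
    starHom (algebraMap ℂ (FreeSAAlg X) c) = algebraMap ℂ _ (starRingEnd ℂ c) := by
  show MonoidAlgebra.liftNC _ _ (MonoidAlgebra.single (1 : FreeMonoid X) c) = _
  rw [MonoidAlgebra.liftNC_single]
  simp

theorem starHom_gen (x : X) : starHom (gen x) = MulOpposite.op (gen x) := by
  show MonoidAlgebra.liftNC _ _ (MonoidAlgebra.single (FreeMonoid.of x) (1 : ℂ)) = _
  rw [MonoidAlgebra.liftNC_single]
  simp

instance : StarRing (FreeSAAlg X) where
  star a := (starHom a).unop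
  star_involutive a := by
    induction a using FreeSAAlg.induction with
    | scalar c => simp [starHom_algebraMap]
    | gen x => simp [starHom_gen]
    | mul a b ha hb => simp [ha, hb]
    | add a b ha hb => simp [ha, hb]
  star_mul a b := by simp
  star_add a b := by simp

theorem star_algebraMap (c : ℂ) :
    star (algebraMap ℂ (FreeSAAlg X) c) = algebraMap ℂ _ (star c) := by
  show (starHom _).unop = _
  rw [starHom_algebraMap]
  rfl

@[simp] theorem star_gen (x : X) : star (gen x) = gen x := by
  show (starHom _).unop = _
  rw [starHom_gen]
  rfl

instance : StarModule ℂ (FreeSAAlg X) where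
  star_smul c a := by
    rw [Algebra.smul_def, star_mul, star_algebraMap, Algebra.smul_def, Algebra.commutes]

theorem eval_star {B : Type*} [Ring B] [StarRing B] [Algebra ℂ B] [StarModule ℂ B]
    (f : X → B) (hf : ∀ x, IsSelfAdjoint (f x)) (a : FreeSAAlg X) :
    eval f (star a) = star (eval f a) := by
  induction a using FreeSAAlg.induction with
  | scalar c => rw [star_algebraMap, AlgHom.commutes, AlgHom.commutes, algebraMap_star_comm]
  | gen x => rw [star_gen, eval_gen, (hf x).star_eq]
  | mul a b ha hb => rw [star_mul, map_mul, map_mul, star_mul, ha, hb]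
  | add a b ha hb => rw [star_add, map_add, map_add, star_add, ha, hb]

end FreeSAAlg

/-- The smallest `*`-invariant relation containing `r`. -/
def StarClosure {R : Type*} [Star R] (r : R → R → Prop) (a b : R) : Prop :=
  r a b ∨ r (star a) (star b)

/-- The universal unital complex `*`-algebra on self-adjoint generators indexed by `X`
subject to the relations `a = b` for all `a b` with `r a b`. -/
def UnivStarAlg {X : Type*} (r : FreeSAAlg X → FreeSAAlg X → Prop) : Type _ :=
  RingQuot (StarClosure r)

namespace UnivStarAlg

variable {X : Type*} {r : FreeSAAlg X → FreeSAAlg X → Prop}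

instance : Ring (UnivStarAlg r) := inferInstanceAs (Ring (RingQuot (StarClosure r)))

instance : Algebra ℂ (UnivStarAlg r) := inferInstanceAs (Algebra ℂ (RingQuot (StarClosure r)))

instance : StarRing (UnivStarAlg r) :=
  RingQuot.starRing (StarClosure r) fun a b h => by
    rcases h with h | h
    · exact Or.inr (by simpa using h)
    · exact Or.inl h

/-- The quotient map. -/
def mk : FreeSAAlg X →ₐ[ℂ] UnivStarAlg r := RingQuot.mkAlgHom ℂ (StarClosure r)

theorem mk_surjective : Function.Surjective (mk (r := r)) :=
  RingQuot.mkAlgHom_surjective ℂ (StarClosure r)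

theorem mk_eq {a b : FreeSAAlg X} (h : r a b) : mk (r := r) a = mk b :=
  RingQuot.mkAlgHom_rel ℂ (Or.inl h)

theorem mk_star (a : FreeSAAlg X) : mk (r := r) (star a) = star (mk a) := by
  have h : ∀ b, mk (r := r) b = (⟨Quot.mk _ b⟩ : RingQuot (StarClosure r)) := by
    intro b
    simp [mk, RingQuot.mkAlgHom_def, RingQuot.mkRingHom_def]
    rfl
  rw [h, h]
  rfl

instance : StarModule ℂ (UnivStarAlg r) where
  star_smul c a := by
    obtain ⟨a, rfl⟩ := mk_surjective a
    rw [← map_smul, ← mk_star, ← mk_star, star_smul, map_smul]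

/-- The generators of the presented algebra. -/
def gen (x : X) : UnivStarAlg r := mk (FreeSAAlg.gen x)

/-- The universal property. -/
def lift {B : Type*} [Ring B] [StarRing B] [Algebra ℂ B] [StarModule ℂ B]
    (f : X → B) (hf : ∀ x, IsSelfAdjoint (f x))
    (hr : ∀ a b, r a b → FreeSAAlg.eval f a = FreeSAAlg.eval f b) : UnivStarAlg r →⋆ₐ[ℂ] B :=
  have hr' : ∀ ⦃a b⦄, StarClosure r a b → FreeSAAlg.eval f a = FreeSAAlg.eval f b := by
    rintro a b (h | h)
    · exact hr a b h
    · have := congrArg star (hr _ _ h)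
      rwa [← FreeSAAlg.eval_star f hf, ← FreeSAAlg.eval_star f hf, star_star, star_star] at this
  { (RingQuot.liftAlgHom ℂ ⟨FreeSAAlg.eval f, hr'⟩ : RingQuot (StarClosure r) →ₐ[ℂ] B) with
    map_star' := fun a => by
      obtain ⟨a, rfl⟩ := mk_surjective a
      rw [← mk_star]
      show RingQuot.liftAlgHom ℂ ⟨FreeSAAlg.eval f, hr'⟩ (RingQuot.mkAlgHom ℂ _ (star a)) =
        star (RingQuot.liftAlgHom ℂ ⟨FreeSAAlg.eval f, hr'⟩ (RingQuot.mkAlgHom ℂ _ a))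
      rw [RingQuot.liftAlgHom_mkAlgHom_apply, RingQuot.liftAlgHom_mkAlgHom_apply,
        FreeSAAlg.eval_star f hf] }

theorem lift_mk {B : Type*} [Ring B] [StarRing B] [Algebra ℂ B] [StarModule ℂ B]
    (f : X → B) (hf : ∀ x, IsSelfAdjoint (f x))
    (hr : ∀ a b, r a b → FreeSAAlg.eval f a = FreeSAAlg.eval f b) (a : FreeSAAlg X) :
    lift f hf hr (mk a) = FreeSAAlg.eval f a :=
  RingQuot.liftAlgHom_mkAlgHom_apply ℂ (FreeSAAlg.eval f) _ a

theorem isSelfAdjoint_gen (x : X) : IsSelfAdjoint (gen (r := r) x) := by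
  rw [IsSelfAdjoint, gen, ← mk_star, FreeSAAlg.star_gen]

end UnivStarAlg

/-! ### The free orthogonal and the hyperoctahedral quantum group -/

/-- The relations `u uᵀ = 1 = uᵀ u` for the matrix `u` of generators. -/
inductive OrthogonalRel (d : ℕ) :
    FreeSAAlg (Fin d × Fin d) → FreeSAAlg (Fin d × Fin d) → Prop
  | row (i i' : Fin d) : OrthogonalRel d
      (∑ j, FreeSAAlg.gen (i, j) * FreeSAAlg.gen (i', j)) (if i = i' then 1 else 0)
  | col (j j' : Fin d) : OrthogonalRel d
      (∑ i, FreeSAAlg.gen (i, j) * FreeSAAlg.gen (i, j')) (if j = j' then 1 else 0)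

/-- The relations of `H_d^+`: orthogonality, `u_ij ^ 3 = u_ij`, and products of two different
entries in the same row or in the same column vanish. -/
inductive HyperoctahedralRel (d : ℕ) :
    FreeSAAlg (Fin d × Fin d) → FreeSAAlg (Fin d × Fin d) → Prop
  | orthogonal {a b : FreeSAAlg (Fin d × Fin d)} (h : OrthogonalRel d a b) :
      HyperoctahedralRel d a b
  | cube (i j : Fin d) : HyperoctahedralRel d
      (FreeSAAlg.gen (i, j) ^ 3) (FreeSAAlg.gen (i, j))
  | row_zero (i j j' : Fin d) (h : j ≠ j') : HyperoctahedralRel d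
      (FreeSAAlg.gen (i, j) * FreeSAAlg.gen (i, j')) 0
  | col_zero (i i' j : Fin d) (h : i ≠ i') : HyperoctahedralRel d
      (FreeSAAlg.gen (i, j) * FreeSAAlg.gen (i', j)) 0

/-- The `*`-algebra `Pol(O_d^+)`. -/
abbrev PolO (d : ℕ) : Type := UnivStarAlg (OrthogonalRel d)

/-- The `*`-algebra `Pol(H_d^+)`. -/
abbrev PolH (d : ℕ) : Type := UnivStarAlg (HyperoctahedralRel d)

/-- The entries of the fundamental corepresentation of `O_d^+`. -/
def PolO.u {d : ℕ} (i j : Fin d) : PolO d := UnivStarAlg.gen (i, j)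

/-- The canonical map `Pol(O_d^+) → Pol(H_d^+)`, `u_ij ↦ u_ij`. -/
def PolO.toPolH (d : ℕ) : PolO d →⋆ₐ[ℂ] PolH d :=
  UnivStarAlg.lift (fun x => UnivStarAlg.gen x) (fun x => UnivStarAlg.isSelfAdjoint_gen x)
    fun a b h => by
      have e : FreeSAAlg.eval (fun x => UnivStarAlg.gen (r := HyperoctahedralRel d) x) =
          UnivStarAlg.mk := by
        ext a
        induction a using FreeSAAlg.induction with
        | scalar c => rw [AlgHom.commutes, AlgHom.commutes]
        | gen x => rw [FreeSAAlg.eval_gen]; rfl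
        | mul a b ha hb => rw [map_mul, map_mul, ha, hb]
        | add a b ha hb => rw [map_add, map_add, ha, hb]
      rw [e]
      exact UnivStarAlg.mk_eq (.orthogonal h)

/-- For a quantum subset `𝕏 ⊂ O_d^+` given by `β : Pol(O_d^+) → Pol(𝕏)`: the inclusion
`𝕏 ⊂ H_d^+`, i.e. `β` factors through `Pol(O_d^+) → Pol(H_d^+)`. -/
def ContainedInH {d : ℕ} {B : Type*} [Ring B] [StarRing B] [Algebra ℂ B]
    (β : PolO d →⋆ₐ[ℂ] B) : Prop :=
  ∃ γ : PolH d →⋆ₐ[ℂ] B, γ.comp (PolO.toPolH d) = β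

/-! ### Non-commutative probability -/

/-- `(A, φ)` is a non-commutative probability space. -/
structure IsNCPS {A : Type*} [Ring A] [StarRing A] [Algebra ℂ A] (φ : A →ₗ[ℂ] ℂ) : Prop where
  map_one : φ 1 = 1
  nonneg : ∀ a : A, 0 ≤ φ (a * star a)

/-- Freeness (with amalgamation) of a family of subalgebras with respect to `E : 𝒜 → ℬ`:
`E (a₀ ⋯ aₙ) = 0` for every alternating product of centred elements. -/
def AreFree {ι 𝒜 ℬ : Type*} [Ring 𝒜] [Algebra ℂ 𝒜] [Ring ℬ] [Algebra ℂ ℬ]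
    (E : 𝒜 →ₗ[ℂ] ℬ) (S : ι → Subalgebra ℂ 𝒜) : Prop :=
  ∀ (n : ℕ) (j : Fin (n + 1) → ι) (a : Fin (n + 1) → 𝒜),
    (∀ k, a k ∈ S (j k)) → (∀ k : Fin n, j k.castSucc ≠ j k.succ) → (∀ k, E (a k) = 0) →
    E (List.ofFn a).prod = 0

/-- Freeness of a family of random variables in `(A, φ)`. -/
def FreeFamily {ι A : Type*} [Ring A] [Algebra ℂ A] (φ : A →ₗ[ℂ] ℂ) (X : ι → A) : Prop :=
  AreFree φ fun i => Algebra.adjoin ℂ {X i}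

/-- The conditional expectation `E = φ ⊗ id : A ⊗ B → B`. -/
def condExpTensor {A : Type*} (B : Type*) [Ring A] [Algebra ℂ A] [Ring B] [Algebra ℂ B]
    (φ : A →ₗ[ℂ] ℂ) : A ⊗[ℂ] B →ₗ[ℂ] B :=
  (TensorProduct.lid ℂ B).toLinearMap ∘ₗ LinearMap.rTensor B φ

/-- Freeness with amalgamation over `B ≅ 1 ⊗ B ⊂ A ⊗ B`, with respect to `E = φ ⊗ id`, of a
family of elements of `A ⊗ B`: the subalgebras generated by `1 ⊗ B` and `Y j` are free. -/
def FreeFamilyOver {ι A B : Type*} [Ring A] [Algebra ℂ A] [Ring B] [Algebra ℂ B]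
    (φ : A →ₗ[ℂ] ℂ) (Y : ι → A ⊗[ℂ] B) : Prop :=
  AreFree (condExpTensor B φ) fun j =>
    Algebra.adjoin ℂ (Set.range (fun b : B => (1 : A) ⊗ₜ[ℂ] b) ∪ {Y j})

/-- The rotated variables `Y_j = ∑ i, X_i ⊗ u̇_ij`, where `u̇_ij = β(u_ij)`. -/
def rotate {d : ℕ} {A B : Type*} [Ring A] [Algebra ℂ A] [Ring B] [StarRing B] [Algebra ℂ B]
    (β : PolO d →⋆ₐ[ℂ] B) (X : Fin d → A) (j : Fin d) : A ⊗[ℂ] B :=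
  ∑ i, X i ⊗ₜ[ℂ] β (PolO.u i j)

/-! ### Free cumulants -/

/-- Non-crossing partitions of `{0, …, n - 1}`. -/
def NonCrossing {n : ℕ} (π : Finpartition (Finset.univ : Finset (Fin n))) : Prop :=
  ∀ B ∈ π.parts, ∀ C ∈ π.parts, B ≠ C →
    ¬ ∃ i₁ ∈ B, ∃ j₁ ∈ C, ∃ i₂ ∈ B, ∃ j₂ ∈ C, i₁ < j₁ ∧ j₁ < i₂ ∧ i₂ < j₂

open Classical in
/-- The set `NC(n)`. -/
def NC (n : ℕ) : Finset (Finpartition (Finset.univ : Finset (Fin n))) :=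
  Finset.univ.filter NonCrossing

/-- The free cumulants `κ_n(a_1, …, a_n)`, defined recursively by solving the moment-cumulant
formula (see `moment_cumulant`) for the term of the one-block partition. In the sum below that
partition contributes `0`, as its block does not have fewer than `n` elements. -/
def freeCumulant {A : Type*} [Ring A] [Algebra ℂ A] (φ : A →ₗ[ℂ] ℂ) (n : ℕ) (a : Fin n → A) : ℂ :=
  φ (List.ofFn a).prod - ∑ π ∈ NC n, ∏ B ∈ π.parts,
    if _h : B.card < n then freeCumulant φ B.card (fun k => a (B.orderEmbOfFin rfl k)) else 0
termination_by n

/-- The moment-cumulant formula. -/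
theorem moment_cumulant {A : Type*} [Ring A] [Algebra ℂ A] (φ : A →ₗ[ℂ] ℂ) (n : ℕ) (hn : n ≠ 0)
    (a : Fin n → A) :
    φ (List.ofFn a).prod = ∑ π ∈ NC n, ∏ B ∈ π.parts,
      freeCumulant φ B.card (fun k => a (B.orderEmbOfFin rfl k)) := by
  classical
  have : NeZero n := ⟨hn⟩
  have hne : (Finset.univ : Finset (Fin n)) ≠ ⊥ := Finset.univ_nonempty.ne_empty
  set t : Finpartition (Finset.univ : Finset (Fin n)) := Finpartition.indiscrete hne with ht
  have htp : t.parts = {Finset.univ} := rfl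
  have htm : t ∈ NC n := by
    simp only [NC, Finset.mem_filter, Finset.mem_univ, true_and]
    intro B hB C hC hBC
    rw [htp, Finset.mem_singleton] at hB hC
    exact absurd (hB.trans hC.symm) hBC
  have hcast : ∀ (m : ℕ) (e : n = m) (f : Fin m → Fin n),
      (∀ k, (f k : ℕ) = k) → freeCumulant φ m (fun k => a (f k)) = freeCumulant φ n a := by
    rintro m rfl f hf
    congr 1
    funext k
    congr 1
    exact Fin.ext (hf k)
  have htop : freeCumulant φ (Finset.univ : Finset (Fin n)).card
      (fun k => a (Finset.univ.orderEmbOfFin rfl k)) = freeCumulant φ n a := by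
    apply hcast _ (by simp)
    intro k
    have h : (Finset.univ : Finset (Fin n)).card = n := by simp
    have := Finset.orderEmbOfFin_unique (s := (Finset.univ : Finset (Fin n))) rfl
      (f := fun k => Fin.cast h k) (fun _ => Finset.mem_univ _) (fun _ _ h => h)
    rw [← congrFun this k]
    rfl
  rw [← Finset.add_sum_erase _ _ htm, htp, Finset.prod_singleton, htop]
  conv_rhs => rw [freeCumulant]
  rw [← Finset.add_sum_erase _ _ htm, htp, Finset.prod_singleton, dif_neg (by simp), zero_add,
    Finset.sum_congr rfl (g := fun π => ∏ B ∈ π.parts,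
      freeCumulant φ B.card (fun k => a (B.orderEmbOfFin rfl k))), sub_add_cancel]
  intro π hπ
  refine Finset.prod_congr rfl fun B hB => dif_pos ?_
  refine lt_of_le_of_ne (by simpa using Finset.card_le_univ B) fun hc => ?_
  have hBu : B = Finset.univ := by
    rw [← Finset.card_eq_iff_eq_univ, hc, Fintype.card_fin]
  subst hBu
  refine (Finset.mem_erase.1 hπ).1 (Finpartition.ext ?_)
  rw [htp]
  refine Finset.eq_singleton_iff_unique_mem.2 ⟨hB, fun C hC => ?_⟩
  by_contra hCB
  have hd := π.disjoint hC hB hCB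
  obtain ⟨x, hx⟩ := π.nonempty_of_mem_parts hC
  exact Finset.disjoint_left.1 hd hx (Finset.mem_univ x)

/-! ### Semicircular variables -/

/-- Wigner's semicircle law, with density `(1 / 2π) √(4 - x²)` on `[-2, 2]`. -/
def wignerLaw : MeasureTheory.Measure ℝ :=
  MeasureTheory.volume.withDensity fun x =>
    ENNReal.ofReal ((Set.Icc (-2 : ℝ) 2).indicator
      (fun x => 1 / (2 * Real.pi) * Real.sqrt (4 - x ^ 2)) x)

/-- The semicircle law with mean `m` and variance `v`: the image of Wigner's law under
`x ↦ m + √v x` (a point mass if `v = 0`). -/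
def semicircleLaw (m : ℝ) (v : ℝ≥0) : MeasureTheory.Measure ℝ :=
  wignerLaw.map fun x => m + Real.sqrt v * x

/-- The self-adjoint variable `a` has distribution `μ` (in moments). -/
structure HasDistribution {A : Type*} [Ring A] [StarRing A] [Algebra ℂ A] (φ : A →ₗ[ℂ] ℂ) (a : A)
    (μ : MeasureTheory.Measure ℝ) : Prop where
  isSelfAdjoint : IsSelfAdjoint a
  isProbabilityMeasure : MeasureTheory.IsProbabilityMeasure μ
  moment : ∀ n : ℕ, 1 ≤ n →
    MeasureTheory.Integrable (fun t : ℝ => t ^ n) μ ∧ φ (a ^ n) = ((∫ t, t ^ n ∂μ : ℝ) : ℂ)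

end

/-! Centre the variables, `x_i = X_i - m`, put `k i j = φ (x_i x_j)`, and form the Wick words
`W(i₁…iₙ) = x_{i₁} W(i₂…iₙ) - k i₁ i₂ W(i₃…iₙ)`. Everything follows from `φ (W l) = 0` for every
nonempty `l` (`FreeFamilyOver.wick_eq_zero`), proved by induction on the length.

Freeness kills `k` off the diagonal, so a word with two different letters factors over its maximal
constant runs into an alternating product of elements centred by induction, and freeness applies
(`AreFree.wick_eq_zero`). A constant word of length `n ≥ 3` has an expectation `c` that does not
depend on the letter. Wick words are multilinear, so a Wick word in the letters `∑ i, x_i ⊗ u̇_ij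
b`, one for each pair `(j, b)`, expands into Wick words of the `x_i` (`wick_tensorSum`), and its
image under `E` is `c ∑ i, u̇_{i j₁} b₁ ⋯ u̇_{i jₙ} bₙ`. If the `j_r` are not all equal, amalgamated
freeness and the same factorization make this zero. Were `c ≠ 0`, suitable `b_r` and the
orthogonality of rows would isolate a single `i` and give `u̇_ij u̇_ij' = 0` for `j ≠ j'`; this
already implies all relations of `H_d^+`, a contradiction.

On constant words `W` is a rescaled Chebyshev polynomial of the second kind in `X_i`, so its
vanishing expectation fixes the moments as those of a semicircle law. For the cumulants, absorbing
the letters of `X_{i₁} ⋯ X_{iₙ}` one at a time into a Wick word writes the mixed moment as a sum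
over non-crossing partitions into singletons and pairs. By the recursion defining cumulants, those
of order at least three vanish. -/

noncomputable section

/-! ### Wick words -/

/-- The Wick word of letters represented by `y`, with covariance `η`. -/
def wick {L R : Type*} [Ring R] (y : L → R) (η : L → L → R) : List L → R
  | [] => 1
  | [a] => y a
  | a :: b :: w => y a * wick y η (b :: w) - η a b * wick y η w

section Wick

variable {L R : Type*} [Ring R] (y : L → R) (η : L → L → R)

@[simp] theorem wick_nil : wick y η [] = 1 := by rw [wick]

@[simp] theorem wick_singleton (a : L) : wick y η [a] = y a := by rw [wick]

theorem wick_cons_cons (a b : L) (w : List L) :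
    wick y η (a :: b :: w) = y a * wick y η (b :: w) - η a b * wick y η w := by
  rw [wick]

/-- The recursion couples only adjacent letters, so the covariance across the junction is the sole
obstruction to multiplicativity. -/
theorem wick_append (w₁ w₂ : List L)
    (h : ∀ a ∈ w₁.getLast?, ∀ b ∈ w₂.head?, η a b = 0) :
    wick y η (w₁ ++ w₂) = wick y η w₁ * wick y η w₂ := by
  induction w₁ using List.twoStepInduction with
  | nil => simp
  | singleton a =>
    cases w₂ with
    | nil => simp
    | cons b w => simp [wick_cons_cons, h a (by simp) b (by simp)]
  | cons_cons a b w ih₁ ih₂ =>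
    rw [List.cons_append, List.cons_append, wick_cons_cons, wick_cons_cons,
      ← List.cons_append, ih₂ b (by simpa using h)]
    cases w with
    | nil => simp [sub_mul, mul_assoc]
    | cons c w => rw [ih₁ (by simpa using h), sub_mul, mul_assoc, mul_assoc]

theorem wick_mem_adjoin [Algebra ℂ R] (S : Subalgebra ℂ R) (w : List L)
    (hy : ∀ a ∈ w, y a ∈ S) (hη : ∀ a ∈ w, ∀ b ∈ w, η a b ∈ S) : wick y η w ∈ S := by
  induction w using List.twoStepInduction with
  | nil => simp
  | singleton a => simpa using hy
  | cons_cons a b w ih₁ ih₂ =>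
    rw [wick_cons_cons]
    refine sub_mem (mul_mem (hy _ (by simp)) (ih₂ b ?_ ?_)) (mul_mem (hη _ (by simp) _ (by simp))
      (ih₁ ?_ ?_))
    · exact fun c hc => hy c (List.mem_cons_of_mem _ hc)
    · exact fun c hc e he => hη c (List.mem_cons_of_mem _ hc) e (List.mem_cons_of_mem _ he)
    · exact fun c hc => hy c (by simp [hc])
    · exact fun c hc e he => hη c (by simp [hc]) e (by simp [he])

theorem wick_flatten (rs : List (List L)) (hne : ∀ r ∈ rs, r ≠ [])
    (h : rs.IsChain fun r s => ∀ a ∈ r.getLast?, ∀ b ∈ s.head?, η a b = 0) :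
    wick y η rs.flatten = (rs.map (wick y η)).prod := by
  induction rs with
  | nil => simp
  | cons r rs ih =>
    rw [List.flatten_cons, List.map_cons, List.prod_cons, wick_append,
      ih (fun s hs => hne s (List.mem_cons_of_mem _ hs)) h.tail]
    cases rs with
    | nil => simp
    | cons s rs =>
      obtain ⟨c, s, rfl⟩ := List.exists_cons_of_ne_nil (hne s (by simp))
      simpa using h.rel

end Wick

/-- Freeness, for alternating products given as lists. -/
theorem AreFree.list_prod {ι 𝒜 ℬ : Type*} [Ring 𝒜] [Algebra ℂ 𝒜] [Ring ℬ] [Algebra ℂ ℬ]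
    {E : 𝒜 →ₗ[ℂ] ℬ} {S : ι → Subalgebra ℂ 𝒜} (h : AreFree E S) (l : List (ι × 𝒜)) (hl : l ≠ [])
    (hS : ∀ p ∈ l, p.2 ∈ S p.1 ∧ E p.2 = 0) (hc : l.IsChain fun p q => p.1 ≠ q.1) :
    E (l.map Prod.snd).prod = 0 := by
  obtain ⟨p, l, rfl⟩ := List.exists_cons_of_ne_nil hl
  have := h l.length (fun k => ((p :: l).get k).1) (fun k => ((p :: l).get k).2)
    (fun k => (hS _ (List.get_mem _ _)).1) (fun k => ?_) (fun k => (hS _ (List.get_mem _ _)).2)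
  · rw [← this]
    congr 2
    conv_lhs => rw [← List.ofFn_get (p :: l), List.map_ofFn]
    rfl
  · have := List.isChain_iff_getElem.1 hc k (by simp)
    simpa using this

/-- A Wick word of free centred Wick words over single colours is centred. -/
theorem AreFree.wick_eq_zero {ι L 𝒜 ℬ : Type*} [DecidableEq ι] [Ring 𝒜] [Algebra ℂ 𝒜] [Ring ℬ]
    [Algebra ℂ ℬ] {E : 𝒜 →ₗ[ℂ] ℬ} {S : ι → Subalgebra ℂ 𝒜} (h : AreFree E S)
    (y : L → 𝒜) (η : L → L → 𝒜) (col : L → ι) (hy : ∀ a, y a ∈ S (col a))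
    (hη : ∀ a b, col a = col b → η a b ∈ S (col a)) (hη0 : ∀ a b, col a ≠ col b → η a b = 0)
    (w : List L) (hw : ∃ a ∈ w, ∃ b ∈ w, col a ≠ col b)
    (hE : ∀ r : List L, r ≠ [] → r.length < w.length → E (wick y η r) = 0) :
    E (wick y η w) = 0 := by
  classical
  -- The maximal runs of one colour: `η` vanishes across their boundaries, so the Wick word is the
  -- product over the runs.
  set rs := w.splitBy (fun a b => col a == col b) with hrs
  have hflat : rs.flatten = w := List.flatten_splitBy _ _
  have hne : ∀ r ∈ rs, r ≠ [] := fun r hr => List.ne_nil_of_mem_splitBy hr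
  have hmono : ∀ r ∈ rs, ∀ a ∈ r, ∀ b ∈ r, col a = col b := by
    intro r hr
    have h1 := List.isChain_of_mem_splitBy hr
    have h2 : r.IsChain (fun a b => col a = col b) := h1.imp fun a b hab => by simpa using hab
    have : IsTrans L (fun a b => col a = col b) := ⟨fun a b c h h' => h.trans h'⟩
    have h3 := List.isChain_iff_pairwise.1 h2
    intro a ha b hb
    have : Std.Symm (fun a b => col a = col b) := ⟨fun _ _ h => h.symm⟩
    exact List.Pairwise.forall_of_forall (R := fun a b => col a = col b) (fun _ _ => rfl) h3 ha hb
  have hch : rs.IsChain fun r s => ∀ a ∈ r.getLast?, ∀ b ∈ s.head?, col a ≠ col b := by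
    refine (List.isChain_getLast_head_splitBy (fun a b => col a == col b) w).imp ?_
    rintro r s ⟨hr, hs, hrs⟩ a ha b hb
    rw [List.getLast?_eq_getLast_of_ne_nil hr, Option.mem_some_iff] at ha
    rw [List.head?_eq_some_head hs, Option.mem_some_iff] at hb
    subst ha hb
    simpa using hrs
  -- A run as long as `w` would be `w` itself, which has two colours; hence `hE` covers every run.
  have hlen : ∀ r ∈ rs, r.length < w.length := by
    intro r hr
    refine lt_of_le_of_ne ?_ fun he => ?_
    · rw [← hflat]
      exact (List.sublist_flatten_of_mem hr).length_le
    · have hr' : r = w := (List.sublist_flatten_of_mem hr).eq_of_length (by rw [hflat, he])|>.trans hflat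
      obtain ⟨a, ha, b, hb, hab⟩ := hw
      exact hab (hmono r hr a (hr' ▸ ha) b (hr' ▸ hb))
  have hw0 : w ≠ [] := by
    rintro rfl
    simp at hw
  obtain ⟨a₀, -⟩ := hw
  -- The colour of a run, read off its head; runs are nonempty, so the default `a₀` plays no role.
  set c : List L → ι := fun r => col (r.headD a₀)
  have hc : ∀ r ∈ rs, ∀ a ∈ r, col a = c r := by
    intro r hr a ha
    obtain ⟨b, r', rfl⟩ := List.exists_cons_of_ne_nil (hne r hr)
    exact hmono _ hr a ha b (by simp)
  have key := h.list_prod (rs.map fun r => (c r, wick y η r)) (by simpa [hrs] using hw0) ?_ ?_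
  · rw [List.map_map] at key
    rw [← hflat, wick_flatten y η rs hne (hch.imp fun r s hh a ha b hb => hη0 a b (hh a ha b hb))]
    exact key
  · intro p hp
    obtain ⟨r, hr, rfl⟩ := List.mem_map.1 hp
    refine ⟨wick_mem_adjoin y η _ r (fun a ha => hc r hr a ha ▸ hy a) (fun a ha b hb => ?_),
      hE r (hne r hr) (hlen r hr)⟩
    show η a b ∈ S (c r)
    rw [← hc r hr a ha]
    exact hη a b (hmono r hr a ha b hb)
  · rw [List.isChain_map]
    refine List.IsChain.imp_of_mem_imp (fun r s hr hs hh => ?_) hch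
    obtain ⟨b, s', rfl⟩ := List.exists_cons_of_ne_nil (hne s hs)
    have h1 := hh _ (List.getLast_mem_getLast? (hne r hr)) b (by simp)
    rwa [hc r hr _ (List.getLast_mem _)] at h1

/-! ### Expansions in `A ⊗ B` -/

section Expansion

variable {ι L A B : Type*} [Fintype ι] [Ring A] [Algebra ℂ A] [Ring B] [Algebra ℂ B]

theorem condExpTensor_tmul (φ : A →ₗ[ℂ] ℂ) (a : A) (b : B) :
    condExpTensor B φ (a ⊗ₜ[ℂ] b) = φ a • b := by
  simp [condExpTensor]

theorem condExpTensor_one_tmul_mul (φ : A →ₗ[ℂ] ℂ) (b : B) (t : A ⊗[ℂ] B) :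
    condExpTensor B φ ((1 ⊗ₜ[ℂ] b) * t) = b * condExpTensor B φ t := by
  induction t with
  | zero => simp
  | tmul a c => simp [condExpTensor_tmul]
  | add s t hs ht => rw [mul_add, map_add, map_add, mul_add, hs, ht]

/-- The sum of `F (i₁, …, iₙ) ⊗ c i₁ a₁ ⋯ c iₙ aₙ` over all indices, for a word `a₁ ⋯ aₙ`. -/
def tensorSum (c : ι → L → B) : List L → (List ι → A) → A ⊗[ℂ] B
  | [], F => F [] ⊗ₜ[ℂ] 1
  | a :: w, F => ∑ i, (1 ⊗ₜ[ℂ] c i a) * tensorSum c w fun l => F (i :: l)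

/-- The sum of `f (i₁, …, iₙ) c i₁ a₁ ⋯ c iₙ aₙ` over all indices, for a word `a₁ ⋯ aₙ`. -/
def coeffSum (c : ι → L → B) : List L → (List ι → ℂ) → B
  | [], f => algebraMap ℂ B (f [])
  | a :: w, f => ∑ i, c i a * coeffSum c w fun l => f (i :: l)

theorem tensorSum_sub (c : ι → L → B) (w : List L) (F G : List ι → A) :
    tensorSum c w (fun l => F l - G l) = tensorSum c w F - tensorSum c w G := by
  induction w generalizing F G with
  | nil => simp [tensorSum, TensorProduct.sub_tmul]
  | cons a w ih => simp only [tensorSum, ih, mul_sub, Finset.sum_sub_distrib]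

theorem tensorSum_mul_left (c : ι → L → B) (w : List L) (a : A) (F : List ι → A) :
    tensorSum c w (fun l => a * F l) = (a ⊗ₜ[ℂ] 1) * tensorSum c w F := by
  induction w generalizing F with
  | nil => simp [tensorSum]
  | cons b w ih => simp [tensorSum, ih, Finset.mul_sum, ← mul_assoc]

theorem condExpTensor_tensorSum (φ : A →ₗ[ℂ] ℂ) (c : ι → L → B) (w : List L) (F : List ι → A) :
    condExpTensor B φ (tensorSum c w F) = coeffSum c w fun l => φ (F l) := by
  induction w generalizing F with
  | nil => simp [tensorSum, coeffSum, condExpTensor_tmul, Algebra.algebraMap_eq_smul_one]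
  | cons b w ih => simp [tensorSum, coeffSum, condExpTensor_one_tmul_mul, ih]

theorem coeffSum_eq_zero (c : ι → L → B) (w : List L) (f : List ι → ℂ)
    (hf : ∀ l, l.length = w.length → f l = 0) : coeffSum c w f = 0 := by
  induction w generalizing f with
  | nil => simp [coeffSum, hf]
  | cons b w ih =>
    rw [coeffSum]
    exact Finset.sum_eq_zero fun i _ => by rw [ih _ fun l hl => hf _ (by simp [hl]), mul_zero]

theorem coeffSum_of_support (c : ι → L → B) (w : List L) (f : List ι → ℂ) (i : ι)
    (hf : ∀ l, l.length = w.length → l ≠ List.replicate w.length i → f l = 0) :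
    coeffSum c w f = f (List.replicate w.length i) • (w.map fun a => c i a).prod := by
  induction w generalizing f with
  | nil => simp [coeffSum, Algebra.algebraMap_eq_smul_one]
  | cons b w ih =>
    rw [coeffSum, Finset.sum_eq_single i, ih]
    · simp [List.replicate_succ]
    · exact fun l hl hne => hf _ (by simp [hl]) (by simpa [List.replicate_succ] using hne)
    · intro j _ hj
      rw [coeffSum_eq_zero, mul_zero]
      exact fun l hl => hf _ (by simp [hl]) (by simp [List.replicate_succ, hj])
    · simp

/-- Meant for expectations of Wick words: mixed index words vanish by freeness, and constant ones
share a value by identical distribution. -/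
theorem coeffSum_of_constant (c : ι → L → B) (w : List L) (hw : w ≠ []) (f : List ι → ℂ) (k : ℂ)
    (hf : ∀ l, l.length = w.length → (∃ a ∈ l, ∃ b ∈ l, a ≠ b) → f l = 0)
    (hk : ∀ i, f (List.replicate w.length i) = k) :
    coeffSum c w f = k • ∑ i, (w.map fun a => c i a).prod := by
  obtain ⟨a, w, rfl⟩ := List.exists_cons_of_ne_nil hw
  rw [coeffSum, Finset.smul_sum]
  refine Finset.sum_congr rfl fun i _ => ?_
  rw [coeffSum_of_support c w _ i]
  · have := hk i
    rw [List.length_cons, List.replicate_succ] at this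
    simp [this]
  · intro l hl hne
    refine hf _ (by simp [hl]) ⟨i, by simp, ?_⟩
    by_contra! h
    exact hne (List.eq_replicate_iff.2 ⟨hl, fun b hb => (h b (by simp [hb])).symm⟩)

/-- Wick words of linear combinations `∑ x i ⊗ c i a` expand into Wick words of the `x i`. -/
theorem wick_tensorSum (φ : A →ₗ[ℂ] ℂ) (x : ι → A) (c : ι → L → B) (w : List L) :
    wick (fun a => ∑ i, x i ⊗ₜ[ℂ] c i a)
        (fun a b => (1 : A) ⊗ₜ[ℂ] ∑ i, ∑ j, φ (x i * x j) • (c i a * c j b)) w =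
      tensorSum c w (wick x fun i j => algebraMap ℂ A (φ (x i * x j))) := by
  induction w using List.twoStepInduction with
  | nil => simp [tensorSum, Algebra.TensorProduct.one_def]
  | singleton a => simp [tensorSum]
  | cons_cons a b w ih₁ ih₂ =>
    -- Since `1 ⊗ b` commutes with `a ⊗ 1`, the coefficients collect in order in the right leg; the
    -- covariance terms agree once the scalar `φ (x i * x j)` crosses the tensor sign.
    rw [wick_cons_cons, ih₁, ih₂]
    simp only [tensorSum, wick_cons_cons, tensorSum_sub, tensorSum_mul_left, mul_sub,
      Finset.sum_sub_distrib, Finset.mul_sum, Finset.sum_mul, TensorProduct.tmul_sum,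
      ← mul_assoc, Algebra.TensorProduct.tmul_mul_tmul, mul_one, one_mul]
    congr 1
    · rw [Finset.sum_comm]
    · simp [Algebra.algebraMap_eq_smul_one, TensorProduct.smul_tmul]

/-- Identifies the covariance of `wick_tensorSum` as `E (y_a y_b)`, which freeness makes vanish
between different colours. -/
theorem condExpTensor_mul (φ : A →ₗ[ℂ] ℂ) (x : ι → A) (c : ι → L → B) (a b : L) :
    condExpTensor B φ ((∑ i, x i ⊗ₜ[ℂ] c i a) * ∑ j, x j ⊗ₜ[ℂ] c j b) =
      ∑ i, ∑ j, φ (x i * x j) • (c i a * c j b) := by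
  simp [Finset.sum_mul_sum, condExpTensor_tmul]

end Expansion

/-! ### Subsets of the hyperoctahedral quantum group -/

section Hyperoctahedral

variable {d : ℕ} {B : Type*} [Ring B] [StarRing B] [Algebra ℂ B]

theorem PolO.eval_gen_eq (β : PolO d →⋆ₐ[ℂ] B) (a : FreeSAAlg (Fin d × Fin d)) :
    FreeSAAlg.eval (fun p => β (PolO.u p.1 p.2)) a = β (UnivStarAlg.mk a) := by
  induction a using FreeSAAlg.induction with
  | scalar c => rw [AlgHom.commutes, AlgHom.commutes]; exact (AlgHomClass.commutes β c).symm
  | gen x => rw [FreeSAAlg.eval_gen]; rfl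
  | mul a b ha hb => rw [map_mul, map_mul, map_mul, ha, hb]
  | add a b ha hb => rw [map_add, map_add, map_add, ha, hb]

theorem PolO.isSelfAdjoint_image (β : PolO d →⋆ₐ[ℂ] B) (i j : Fin d) :
    IsSelfAdjoint (β (PolO.u i j)) :=
  (UnivStarAlg.isSelfAdjoint_gen (r := OrthogonalRel d) (i, j)).map β

theorem PolO.sum_row (β : PolO d →⋆ₐ[ℂ] B) (i i' : Fin d) :
    ∑ j, β (PolO.u i j) * β (PolO.u i' j) = if i = i' then 1 else 0 := by
  have := congrArg β (UnivStarAlg.mk_eq (OrthogonalRel.row i i'))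
  rw [← PolO.eval_gen_eq, ← PolO.eval_gen_eq] at this
  rw [map_sum] at this
  simp only [map_mul, FreeSAAlg.eval_gen] at this
  rw [this]
  split_ifs <;> simp

theorem containedInH_of_relations [StarModule ℂ B] (β : PolO d →⋆ₐ[ℂ] B)
    (hcube : ∀ i j, β (PolO.u i j) ^ 3 = β (PolO.u i j))
    (hrow : ∀ i j j', j ≠ j' → β (PolO.u i j) * β (PolO.u i j') = 0)
    (hcol : ∀ i i' j, i ≠ i' → β (PolO.u i j) * β (PolO.u i' j) = 0) : ContainedInH β := by
  have hrel : ∀ a b, HyperoctahedralRel d a b →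
      FreeSAAlg.eval (fun p => β (PolO.u p.1 p.2)) a =
        FreeSAAlg.eval (fun p => β (PolO.u p.1 p.2)) b := by
    intro a b h
    cases h with
    | orthogonal h =>
      rw [PolO.eval_gen_eq, PolO.eval_gen_eq, UnivStarAlg.mk_eq h]
    | cube i j => rw [map_pow, FreeSAAlg.eval_gen]; exact hcube i j
    | row_zero i j j' h =>
      rw [map_mul, FreeSAAlg.eval_gen, FreeSAAlg.eval_gen, map_zero]; exact hrow i j j' h
    | col_zero i i' j h =>
      rw [map_mul, FreeSAAlg.eval_gen, FreeSAAlg.eval_gen, map_zero]; exact hcol i i' j h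
  refine ⟨UnivStarAlg.lift _ (fun p => PolO.isSelfAdjoint_image β p.1 p.2) hrel, ?_⟩
  ext a
  obtain ⟨a, rfl⟩ := UnivStarAlg.mk_surjective a
  have : PolO.toPolH d (UnivStarAlg.mk a) = UnivStarAlg.mk a := by
    rw [PolO.toPolH, UnivStarAlg.lift_mk]
    induction a using FreeSAAlg.induction with
    | scalar c => rw [AlgHom.commutes, AlgHom.commutes]
    | gen x => rw [FreeSAAlg.eval_gen]; rfl
    | mul a b ha hb => rw [map_mul, map_mul, ha, hb]
    | add a b ha hb => rw [map_add, map_add, ha, hb]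
  rw [StarAlgHom.comp_apply, this, UnivStarAlg.lift_mk, PolO.eval_gen_eq]

/-- If products of different entries of a row vanish, then all relations of `H_d^+` hold. -/
theorem containedInH_of_row_zero [StarModule ℂ B] (β : PolO d →⋆ₐ[ℂ] B)
    (hrow : ∀ i j j', j ≠ j' → β (PolO.u i j) * β (PolO.u i j') = 0) : ContainedInH β := by
  have hcube : ∀ i j, β (PolO.u i j) ^ 3 = β (PolO.u i j) := by
    intro i j
    -- In `u_ij ∑ l, u_il u_il = u_ij` only the term `l = j` survives.
    have h := congrArg (fun t => β (PolO.u i j) * t) (PolO.sum_row β i i)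
    rw [if_pos rfl, mul_one, Finset.mul_sum, Finset.sum_eq_single j] at h
    · rw [pow_three]; exact h
    · intro j' _ hj
      rw [← mul_assoc, hrow i j j' hj.symm, zero_mul]
    · simp
  refine containedInH_of_relations β hcube hrow fun i i' j hi => ?_
  -- Likewise `u_ij ∑ l, u_il u_i'l = 0` reduces to `u_ij² u_i'j = 0`; one more factor `u_ij` and
  -- the cube relation give the column relation.
  have h := congrArg (fun t => β (PolO.u i j) * t) (PolO.sum_row β i i')
  rw [if_neg hi, mul_zero, Finset.mul_sum, Finset.sum_eq_single j] at h
  · rw [← hcube i j, pow_three, mul_assoc, mul_assoc, h, mul_zero]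
  · intro j' _ hj
    rw [← mul_assoc, hrow i j j' hj.symm, zero_mul]
  · simp

/-- Take the coefficient `u_kl` after `u_il` and sum over `l`: row orthogonality `∑ l, u_il u_kl =
δ_ik` singles out `i = k`. Longer words lose a letter by absorbing `u_il u_kl` into `p i`. -/
theorem eq_zero_of_sum_mul_prod_eq_zero (β : PolO d →⋆ₐ[ℂ] B) (n : ℕ) (p : Fin d → B)
    (h : ∀ w : List (Fin d × B), w.length = n + 1 →
      ∑ i, p i * (w.map fun a => β (PolO.u i a.1) * a.2).prod = 0) (k : Fin d) : p k = 0 := by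
  induction n generalizing p k with
  | zero =>
    have hl : ∀ l, ∑ i, p i * (β (PolO.u i l) * β (PolO.u k l)) = 0 := fun l => by
      simpa using h [(l, β (PolO.u k l))] rfl
    have := Finset.sum_eq_zero fun l (_ : l ∈ Finset.univ) => hl l
    rw [Finset.sum_comm] at this
    simpa [← Finset.mul_sum, PolO.sum_row] using this
  | succ n ih =>
    have hl : ∀ l, p k * (β (PolO.u k l) * β (PolO.u k l)) = 0 := fun l =>
      ih (fun i => p i * (β (PolO.u i l) * β (PolO.u k l)))
        (fun w hw => by simpa [mul_assoc] using h ((l, β (PolO.u k l)) :: w) (by simp [hw])) k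
    simpa [← Finset.mul_sum, PolO.sum_row] using
      Finset.sum_eq_zero fun l (_ : l ∈ Finset.univ) => hl l

/-- Two letters produce the row product `u_ij u_ij'`, and at least one more is needed to isolate the
index `i`; hence `3 ≤ n`. -/
theorem containedInH_of_sum_prod_eq_zero [StarModule ℂ B] (β : PolO d →⋆ₐ[ℂ] B) (n : ℕ)
    (hn : 3 ≤ n)
    (h : ∀ w : List (Fin d × B), w.length = n → (∃ a ∈ w, ∃ b ∈ w, a.1 ≠ b.1) →
      ∑ i, (w.map fun a => β (PolO.u i a.1) * a.2).prod = 0) : ContainedInH β := by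
  obtain ⟨n, rfl⟩ := Nat.exists_eq_add_of_le' hn
  refine containedInH_of_row_zero β fun i j j' hj => ?_
  refine eq_zero_of_sum_mul_prod_eq_zero β n
    (fun i => β (PolO.u i j) * β (PolO.u i j')) (fun w hw => ?_) i
  simpa [mul_assoc] using h ((j, 1) :: (j', 1) :: w) (by simp [hw])
    ⟨(j, 1), by simp, (j', 1), by simp, hj⟩

end Hyperoctahedral

/-! ### Vanishing of the expectations of Wick words -/

/-- The monic orthogonal polynomials of the semicircle law with mean `m` and variance `v`. -/
def semicirclePoly (m v : ℂ) : ℕ → Polynomial ℂ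
  | 0 => 1
  | 1 => Polynomial.X - Polynomial.C m
  | n + 2 => (Polynomial.X - Polynomial.C m) * semicirclePoly m v (n + 1) -
      Polynomial.C v * semicirclePoly m v n

section Vanishing

variable {ι A : Type*} [Ring A] [Algebra ℂ A] {φ : A →ₗ[ℂ] ℂ} {X : ι → A} {m : ℂ}

theorem apply_aeval_eq (hid : ∀ (i i' : ι) (n : ℕ), φ (X i ^ n) = φ (X i' ^ n)) (i i' : ι)
    (p : Polynomial ℂ) : φ (Polynomial.aeval (X i) p) = φ (Polynomial.aeval (X i') p) := by
  induction p using Polynomial.induction_on' with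
  | add p q hp hq => simp only [map_add, hp, hq]
  | monomial n c => simp [Polynomial.aeval_monomial, ← Algebra.smul_def, hid i i' n]

theorem wick_replicate (i : ι) (k : ι → ι → ℂ) (n : ℕ) :
    wick (fun i => X i - algebraMap ℂ A m) (fun i j => algebraMap ℂ A (k i j))
      (List.replicate n i) = Polynomial.aeval (X i) (semicirclePoly m (k i i) n) := by
  induction n using Nat.twoStepInduction with
  | zero => simp [semicirclePoly]
  | one => simp [semicirclePoly]
  | more n ih₁ ih₂ =>
    rw [List.replicate_succ] at ih₂
    rw [List.replicate_succ, List.replicate_succ, wick_cons_cons, ih₁, ih₂, semicirclePoly]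
    simp

theorem sub_algebraMap_mem_adjoin (i : ι) :
    X i - algebraMap ℂ A m ∈ Algebra.adjoin ℂ {X i} :=
  sub_mem (Algebra.subset_adjoin rfl) (Subalgebra.algebraMap_mem _ _)

theorem FreeFamily.apply_mul_eq_zero (h : FreeFamily φ X) (h1 : φ 1 = 1) (hm : ∀ i, φ (X i) = m)
    {i j : ι} (hij : i ≠ j) :
    φ ((X i - algebraMap ℂ A m) * (X j - algebraMap ℂ A m)) = 0 := by
  have h0 : ∀ i, φ (X i - algebraMap ℂ A m) = 0 := fun i => by
    simp [Algebra.algebraMap_eq_smul_one, hm, h1]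
  simpa using AreFree.list_prod h
    [(i, X i - algebraMap ℂ A m), (j, X j - algebraMap ℂ A m)] (by simp)
    (by simp [sub_algebraMap_mem_adjoin, h0]) (by simpa using hij)

theorem FreeFamily.wick_eq_zero [DecidableEq ι] (h : FreeFamily φ X) (k : ι → ι → ℂ)
    (hk : ∀ i j, i ≠ j → k i j = 0) (w : List ι)
    (hw : ∃ a ∈ w, ∃ b ∈ w, a ≠ b)
    (hE : ∀ r : List ι, r ≠ [] → r.length < w.length →
      φ (wick (fun i => X i - algebraMap ℂ A m) (fun i j => algebraMap ℂ A (k i j)) r) = 0) :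
    φ (wick (fun i => X i - algebraMap ℂ A m) (fun i j => algebraMap ℂ A (k i j)) w) = 0 :=
  AreFree.wick_eq_zero h _ _ id sub_algebraMap_mem_adjoin
    (fun _ _ _ => Subalgebra.algebraMap_mem _ _) (fun i j hij => by simp [hk i j hij]) w hw hE

end Vanishing

/-! ### Rotated variables and the main induction -/

theorem one_tmul_mem_adjoin {A B : Type*} [Ring A] [Algebra ℂ A] [Ring B] [Algebra ℂ B]
    (Y : A ⊗[ℂ] B) (b : B) :
    (1 : A) ⊗ₜ[ℂ] b ∈
      Algebra.adjoin ℂ (Set.range (fun b : B => (1 : A) ⊗ₜ[ℂ] b) ∪ {Y}) :=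
  Algebra.subset_adjoin (Or.inl ⟨b, rfl⟩)

section Rotation

variable {d : ℕ} {A : Type*} [Ring A] [Algebra ℂ A] {φ : A →ₗ[ℂ] ℂ} {X : Fin d → A}
  {B : Type*} [Ring B] [StarRing B] [Algebra ℂ B] {β : PolO d →⋆ₐ[ℂ] B} {m : ℂ}

/-- Centring changes `Y_j` only by an element of `1 ⊗ B`, and the coefficient `a.2` is a right
factor from `1 ⊗ B`. -/
theorem rotate_sub_mem_adjoin (m : ℂ) (a : Fin d × B) :
    ∑ i, (X i - algebraMap ℂ A m) ⊗ₜ[ℂ] (β (PolO.u i a.1) * a.2) ∈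
      Algebra.adjoin ℂ (Set.range (fun b : B => (1 : A) ⊗ₜ[ℂ] b) ∪ {rotate β X a.1}) := by
  have e : ∑ i, (X i - algebraMap ℂ A m) ⊗ₜ[ℂ] (β (PolO.u i a.1) * a.2) =
      (rotate β X a.1 - (1 : A) ⊗ₜ[ℂ] (m • ∑ i, β (PolO.u i a.1))) * ((1 : A) ⊗ₜ[ℂ] a.2) := by
    simp only [rotate, Finset.smul_sum, TensorProduct.tmul_sum, sub_mul, Finset.sum_mul,
      Algebra.TensorProduct.tmul_mul_tmul, mul_one, TensorProduct.sub_tmul,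
      Finset.sum_sub_distrib, Algebra.algebraMap_eq_smul_one, smul_mul_assoc,
      TensorProduct.smul_tmul]
  rw [e]
  exact mul_mem (sub_mem (Algebra.subset_adjoin (Or.inr rfl)) (one_tmul_mem_adjoin _ _))
    (one_tmul_mem_adjoin _ _)

theorem FreeFamilyOver.covariance_eq_zero (hY : FreeFamilyOver φ (rotate β X))
    (h0 : ∀ i, φ (X i - algebraMap ℂ A m) = 0) {a b : Fin d × B} (hab : a.1 ≠ b.1) :
    ∑ i, ∑ j, φ ((X i - algebraMap ℂ A m) * (X j - algebraMap ℂ A m)) •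
      (β (PolO.u i a.1) * a.2 * (β (PolO.u j b.1) * b.2)) = 0 := by
  rw [← condExpTensor_mul φ (fun i => X i - algebraMap ℂ A m)
    (fun i (a : Fin d × B) => β (PolO.u i a.1) * a.2)]
  have key := AreFree.list_prod hY
    [(a.1, ∑ i, (X i - algebraMap ℂ A m) ⊗ₜ[ℂ] (β (PolO.u i a.1) * a.2)),
      (b.1, ∑ i, (X i - algebraMap ℂ A m) ⊗ₜ[ℂ] (β (PolO.u i b.1) * b.2))] (by simp) ?_
    (by simpa using hab)
  · simpa using key
  · intro p hp
    obtain rfl | rfl := List.mem_pair.1 hp <;>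
      exact ⟨rotate_sub_mem_adjoin m _, by simp [condExpTensor_tmul, h0]⟩

/-- Under the hypotheses of the main theorem, all Wick words of positive length are centred. -/
theorem FreeFamilyOver.wick_eq_zero [StarModule ℂ B] (hH : ¬ ContainedInH β) (h1 : φ 1 = 1)
    (hfree : FreeFamily φ X)
    (hid : ∀ (i i' : Fin d) (n : ℕ), φ (X i ^ n) = φ (X i' ^ n))
    (hY : FreeFamilyOver φ (rotate β X)) (hm : ∀ i, φ (X i) = m) (l : List (Fin d)) (hl : l ≠ []) :
    φ (wick (fun i => X i - algebraMap ℂ A m)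
      (fun i j => algebraMap ℂ A (φ ((X i - algebraMap ℂ A m) * (X j - algebraMap ℂ A m)))) l)
      = 0 := by
  set k : Fin d → Fin d → ℂ :=
    fun i j => φ ((X i - algebraMap ℂ A m) * (X j - algebraMap ℂ A m)) with hk
  have h0 : ∀ i, φ (X i - algebraMap ℂ A m) = 0 := fun i => by
    simp [Algebra.algebraMap_eq_smul_one, hm, h1]
  have hs : ∀ c : ℂ, φ (algebraMap ℂ A c) = c := fun c => by
    simp [Algebra.algebraMap_eq_smul_one, h1]
  have hkd : ∀ i j, i ≠ j → k i j = 0 := fun i j => hfree.apply_mul_eq_zero h1 hm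
  induction hn : l.length using Nat.strong_induction_on generalizing l with
  | _ n ih =>
  subst hn
  -- Needed for all mixed words of this length, not just `l`: they all occur in the expansion of a
  -- rotated Wick word.
  have hmixed : ∀ l' : List (Fin d), l'.length = l.length → (∃ a ∈ l', ∃ b ∈ l', a ≠ b) →
      φ (wick (fun i => X i - algebraMap ℂ A m) (fun i j => algebraMap ℂ A (k i j)) l') = 0 :=
    fun l' hl' hw => hfree.wick_eq_zero k hkd l' hw fun r hr hlt => ih _ (hl' ▸ hlt) r hr rfl
  by_cases hw : ∃ a ∈ l, ∃ b ∈ l, a ≠ b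
  · exact hmixed l rfl hw
  obtain ⟨i, hi⟩ : ∃ i, l = List.replicate l.length i := by
    obtain ⟨i, l', rfl⟩ := List.exists_cons_of_ne_nil hl
    push Not at hw
    exact ⟨i, List.eq_replicate_iff.2 ⟨rfl, fun b hb => hw b hb i (by simp)⟩⟩
  obtain hn | hn | hn : l.length = 1 ∨ l.length = 2 ∨ 3 ≤ l.length := by
    have := List.length_pos_iff.2 hl
    omega
  · rw [hi, hn]
    simpa using h0 i
  · rw [hi, hn, List.replicate_succ, List.replicate_succ, wick_cons_cons]
    simp [hs]
  by_contra hc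
  have hconst : ∀ i', φ (wick (fun i => X i - algebraMap ℂ A m)
      (fun i j => algebraMap ℂ A (k i j)) (List.replicate l.length i')) =
      φ (wick (fun i => X i - algebraMap ℂ A m)
      (fun i j => algebraMap ℂ A (k i j)) l) := by
    intro i'
    -- As the expectation of a polynomial in `X i`, the variance is also independent of `i`.
    have e : ∀ i, k i i = φ (Polynomial.aeval (X i)
        ((Polynomial.X - Polynomial.C m) * (Polynomial.X - Polynomial.C m))) := by simp [hk]
    conv_rhs => rw [hi]
    rw [wick_replicate, wick_replicate, apply_aeval_eq hid i' i, e, e, apply_aeval_eq hid i' i]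
  refine hH (containedInH_of_sum_prod_eq_zero β l.length hn fun w hwl hw => ?_)
  -- The colour of a letter `(j, b)` is `j`; the coefficient `b` is free because `1 ⊗ B` lies in
  -- every one of the amalgamated subalgebras.
  have key := AreFree.wick_eq_zero hY
    (fun a : Fin d × B => ∑ i, (X i - algebraMap ℂ A m) ⊗ₜ[ℂ] (β (PolO.u i a.1) * a.2))
    (fun a b => (1 : A) ⊗ₜ[ℂ] ∑ i, ∑ j, k i j •
      (β (PolO.u i a.1) * a.2 * (β (PolO.u j b.1) * b.2)))
    Prod.fst (rotate_sub_mem_adjoin m) (fun a b _ => one_tmul_mem_adjoin _ _)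
    (fun a b hab => by simp [hk, hY.covariance_eq_zero h0 hab]) w hw ?_
  · rw [wick_tensorSum φ (fun i => X i - algebraMap ℂ A m) (fun i (a : Fin d × B) => β (PolO.u i a.1) * a.2),
      condExpTensor_tensorSum, coeffSum_of_constant _ _ ?_ _ _ ?_ (hwl ▸ hconst)] at key
    · exact (smul_eq_zero.1 key).resolve_left hc
    · rintro rfl
      simp at hw
    · exact fun l' hl' => hmixed l' (hl'.trans hwl)
  -- Shorter rotated words are centred, since every Wick word in their expansion is, by induction.
  · intro r hr hlt
    rw [wick_tensorSum φ (fun i => X i - algebraMap ℂ A m) (fun i (a : Fin d × B) => β (PolO.u i a.1) * a.2),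
      condExpTensor_tensorSum]
    refine coeffSum_eq_zero _ _ _ fun l' hl' => ih l'.length (by omega) l' ?_ rfl
    rintro rfl
    exact hr (List.length_eq_zero_iff.1 hl'.symm)

end Rotation

/-! ### Moments of the semicircle law -/

open MeasureTheory Polynomial in
theorem integral_wignerLaw {F : Type*} [NormedAddCommGroup F] [NormedSpace ℝ F] (f : ℝ → F) :
    ∫ x, f x ∂wignerLaw =
      ∫ x in Set.Icc (-2 : ℝ) 2, (1 / (2 * Real.pi) * Real.sqrt (4 - x ^ 2)) • f x := by
  rw [wignerLaw, integral_withDensity_eq_integral_toReal_smul₀, ← integral_indicator]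
  · congr 1
    funext x
    by_cases hx : x ∈ Set.Icc (-2 : ℝ) 2
    · rw [Set.indicator_of_mem hx, Set.indicator_of_mem hx, ENNReal.toReal_ofReal]
      positivity
    · rw [Set.indicator_of_notMem hx, Set.indicator_of_notMem hx]
      simp
  · exact measurableSet_Icc
  · exact (((by fun_prop : Measurable fun x : ℝ =>
      1 / (2 * Real.pi) * Real.sqrt (4 - x ^ 2)).indicator measurableSet_Icc).ennreal_ofReal).aemeasurable
  · simp

open MeasureTheory in
theorem integrable_wignerLaw {F : Type*} [NormedAddCommGroup F] [NormedSpace ℝ F] {f : ℝ → F}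
    (hf : Continuous f) : Integrable f wignerLaw := by
  rw [wignerLaw, integrable_withDensity_iff_integrable_smul']
  · have : (fun x => (ENNReal.ofReal ((Set.Icc (-2 : ℝ) 2).indicator
        (fun x => 1 / (2 * Real.pi) * Real.sqrt (4 - x ^ 2)) x)).toReal • f x) =
        (Set.Icc (-2 : ℝ) 2).indicator
          fun x => (1 / (2 * Real.pi) * Real.sqrt (4 - x ^ 2)) • f x := by
      funext x
      by_cases hx : x ∈ Set.Icc (-2 : ℝ) 2
      · rw [Set.indicator_of_mem hx, Set.indicator_of_mem hx, ENNReal.toReal_ofReal]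
        positivity
      · rw [Set.indicator_of_notMem hx, Set.indicator_of_notMem hx]
        simp
    rw [this, integrable_indicator_iff measurableSet_Icc]
    exact (Continuous.continuousOn (by fun_prop)).integrableOn_Icc
  · exact ((by fun_prop : Measurable fun x : ℝ =>
      1 / (2 * Real.pi) * Real.sqrt (4 - x ^ 2)).indicator measurableSet_Icc).ennreal_ofReal
  · simp

open MeasureTheory in
-- Substitute `x = 2y` and write `√(1 - y²) = (1 - y²) / √(1 - y²)`, which also holds at the
-- endpoints as `0 / 0 = 0`.
theorem integral_wignerLaw_eq_measureT (f : ℝ → ℝ) :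
    ∫ x, f (x / 2) ∂wignerLaw =
      2 / Real.pi * ∫ x, (1 - x ^ 2) * f x ∂Polynomial.Chebyshev.measureT := by
  rw [integral_wignerLaw, Polynomial.Chebyshev.integral_measureT, integral_Icc_eq_integral_Ioc,
    ← intervalIntegral.integral_of_le (by norm_num)]
  have h := intervalIntegral.integral_comp_mul_left (a := -1) (b := 1)
    (fun x => (1 / (2 * Real.pi) * Real.sqrt (4 - x ^ 2)) • f (x / 2)) (two_ne_zero (α := ℝ))
  have h2 : ∫ x in (2 * -1 : ℝ)..(2 * 1), (1 / (2 * Real.pi) * Real.sqrt (4 - x ^ 2)) • f (x / 2) =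
      2 * ∫ x in (-1 : ℝ)..1,
        (1 / (2 * Real.pi) * Real.sqrt (4 - (2 * x) ^ 2)) • f (2 * x / 2) := by
    rw [h]; simp
  rw [show (-2 : ℝ) = 2 * -1 by norm_num, show (2 : ℝ) = 2 * 1 by norm_num]
  norm_num at h2 ⊢
  rw [h2, ← intervalIntegral.integral_const_mul, ← intervalIntegral.integral_const_mul]
  refine intervalIntegral.integral_congr fun x hx => ?_
  have hx' : 0 ≤ 1 - x ^ 2 := by
    rw [Set.uIcc_of_le (by norm_num)] at hx
    nlinarith [hx.1, hx.2]
  have e : Real.sqrt (4 - (2 * x) ^ 2) = 2 * Real.sqrt (1 - x ^ 2) := by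
    rw [show 4 - (2 * x) ^ 2 = 2 ^ 2 * (1 - x ^ 2) by ring, Real.sqrt_mul (by norm_num),
      Real.sqrt_sq (by norm_num)]
  have e2 : (1 - x ^ 2) * (Real.sqrt (1 - x ^ 2))⁻¹ = Real.sqrt (1 - x ^ 2) := by
    rw [← div_eq_mul_inv, Real.div_sqrt]
  simp only [e]
  rw [mul_right_comm (1 - x ^ 2), e2]
  field_simp

open MeasureTheory Polynomial in
-- From `(1 - x²) U_n = (T_n - T_{n+2}) / 2`, as only `T_0` has a nonzero integral against
-- `measureT`.
theorem integral_wignerLaw_chebyshev (n : ℕ) :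
    ∫ x, (Chebyshev.U ℝ n).eval (x / 2) ∂wignerLaw = if n = 0 then 1 else 0 := by
  rw [integral_wignerLaw_eq_measureT fun x => (Chebyshev.U ℝ n).eval x]
  have h : ∀ x : ℝ, (1 - x ^ 2) * (Chebyshev.U ℝ n).eval x =
      ((Chebyshev.T ℝ n).eval x - (Chebyshev.T ℝ (n + 2 : ℤ)).eval x) / 2 := by
    intro x
    have h1 := congrArg (Polynomial.eval x) (Chebyshev.one_sub_X_sq_mul_U_eq_pol_in_T ℝ n)
    have h2 := congrArg (Polynomial.eval x) (Chebyshev.T_add_two ℝ n)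
    simp only [eval_mul, eval_sub, eval_one, eval_pow, eval_X, eval_ofNat] at h1 h2
    rw [h1]
    linarith
  simp_rw [h]
  rw [integral_div, integral_sub (Chebyshev.integrable_measureT (by fun_prop))
    (Chebyshev.integrable_measureT (by fun_prop)),
    Chebyshev.integral_eval_T_real_measureT_of_ne_zero (n := n + 2) (by omega)]
  split_ifs with hn
  · subst hn
    rw [Nat.cast_zero, Chebyshev.integral_eval_T_real_measureT_zero]
    field_simp
    simp
  · rw [Chebyshev.integral_eval_T_real_measureT_of_ne_zero (by exact_mod_cast hn)]
    simp

open MeasureTheory in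
instance isProbabilityMeasure_wignerLaw : IsProbabilityMeasure wignerLaw := by
  have h := integral_wignerLaw_chebyshev 0
  have : IsFiniteMeasure wignerLaw :=
    (integrable_const_iff_isFiniteMeasure (one_ne_zero (α := ℝ))).1
      (integrable_wignerLaw continuous_const)
  refine ⟨(ENNReal.toReal_eq_one_iff _).1 ?_⟩
  simpa [Measure.real] using h

theorem eval_semicirclePoly (m σ s : ℝ) (n : ℕ) :
    (semicirclePoly m ((σ ^ 2 : ℝ) : ℂ) n).eval ((m + σ * s : ℝ) : ℂ) =
      ((σ ^ n * (Polynomial.Chebyshev.U ℝ n).eval (s / 2) : ℝ) : ℂ) := by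
  induction n using Nat.twoStepInduction with
  | zero => simp [semicirclePoly]
  | one => simp [semicirclePoly]; left; ring
  | more n ih₁ ih₂ =>
    rw [semicirclePoly, Polynomial.eval_sub, Polynomial.eval_mul, Polynomial.eval_mul, ih₁, ih₂]
    have := congrArg (Polynomial.eval (s / 2 : ℂ)) (Polynomial.Chebyshev.U_add_two ℂ n)
    push_cast
    rw [this]
    simp
    ring

/-- With `P_n` for `semicirclePoly m v n`, the recurrence `X P_{n+1} = P_{n+2} + m P_{n+1} + v P_n`
gives `D (X^k P_n) = 0` for all `n`, by induction on `k`. -/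
theorem linearMap_eq_zero_of_semicirclePoly (m v : ℂ) (D : Polynomial ℂ →ₗ[ℂ] ℂ)
    (h : ∀ n, D (semicirclePoly m v n) = 0) (k : ℕ) : D (Polynomial.X ^ k) = 0 := by
  have key : ∀ k n, D (Polynomial.X ^ k * semicirclePoly m v n) = 0 := by
    intro k
    induction k with
    | zero => simpa using h
    | succ k ih =>
      intro n
      cases n with
      | zero =>
        have e : Polynomial.X ^ (k + 1) * semicirclePoly m v 0 =
            Polynomial.X ^ k * semicirclePoly m v 1 +
              m • (Polynomial.X ^ k * semicirclePoly m v 0) := by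
          rw [semicirclePoly, semicirclePoly, Polynomial.smul_eq_C_mul]
          ring
        rw [e, map_add, map_smul, ih, ih, smul_zero, add_zero]
      | succ n =>
        have e : Polynomial.X ^ (k + 1) * semicirclePoly m v (n + 1) =
            Polynomial.X ^ k * semicirclePoly m v (n + 2) +
              m • (Polynomial.X ^ k * semicirclePoly m v (n + 1)) +
              v • (Polynomial.X ^ k * semicirclePoly m v n) := by
          rw [semicirclePoly, Polynomial.smul_eq_C_mul, Polynomial.smul_eq_C_mul]
          ring
        rw [e, map_add, map_add, map_smul, map_smul, ih, ih, ih, smul_zero, smul_zero, add_zero,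
          add_zero]
  simpa [semicirclePoly] using key k 0

/-- Integration of polynomials against the law of `m + σ s`, for `s` distributed by Wigner's
law. -/
def wignerFunctional (m σ : ℝ) : Polynomial ℂ →ₗ[ℂ] ℂ where
  toFun p := ∫ s, p.eval ((m + σ * s : ℝ) : ℂ) ∂wignerLaw
  map_add' p q := by
    simp only [Polynomial.eval_add]
    exact MeasureTheory.integral_add (integrable_wignerLaw (by fun_prop))
      (integrable_wignerLaw (by fun_prop))
  map_smul' c p := by
    simp [MeasureTheory.integral_const_mul]

theorem wignerFunctional_semicirclePoly (m σ : ℝ) (n : ℕ) :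
    wignerFunctional m σ (semicirclePoly m ((σ ^ 2 : ℝ) : ℂ) n) = if n = 0 then 1 else 0 := by
  show ∫ s, (semicirclePoly m ((σ ^ 2 : ℝ) : ℂ) n).eval ((m + σ * s : ℝ) : ℂ) ∂wignerLaw = _
  simp_rw [eval_semicirclePoly]
  rw [integral_complex_ofReal, MeasureTheory.integral_const_mul, integral_wignerLaw_chebyshev]
  split_ifs with h <;> simp [h]

theorem hasDistribution_semicircleLaw {A : Type*} [Ring A] [StarRing A] [Algebra ℂ A]
    (φ : A →ₗ[ℂ] ℂ) (h1 : φ 1 = 1) (a : A) (ha : IsSelfAdjoint a) (m : ℝ) (v : ℝ≥0)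
    (h : ∀ n, n ≠ 0 → φ (Polynomial.aeval a (semicirclePoly m (v : ℝ) n)) = 0) :
    HasDistribution φ a (semicircleLaw m v) := by
  have hmeas : Measurable fun x : ℝ => m + Real.sqrt v * x := by fun_prop
  have hv : (((Real.sqrt v) ^ 2 : ℝ) : ℂ) = ((v : ℝ) : ℂ) := by
    rw [Real.sq_sqrt v.coe_nonneg]
  refine ⟨ha, MeasureTheory.Measure.isProbabilityMeasure_map hmeas.aemeasurable,
    fun n _ => ⟨?_, ?_⟩⟩
  · rw [semicircleLaw, MeasureTheory.integrable_map_measure (by fun_prop) hmeas.aemeasurable]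
    exact integrable_wignerLaw (by fun_prop)
  · rw [semicircleLaw, MeasureTheory.integral_map hmeas.aemeasurable (by fun_prop)]
    -- Both functionals send `P_0 = 1` to `1` and all later orthogonal polynomials to `0`, so their
    -- difference vanishes.
    have key := linearMap_eq_zero_of_semicirclePoly m (v : ℝ)
      (φ ∘ₗ (Polynomial.aeval a).toLinearMap - wignerFunctional m (Real.sqrt v)) (fun k => ?_) n
    · rw [LinearMap.sub_apply, sub_eq_zero] at key
      have e : wignerFunctional m (Real.sqrt v) (Polynomial.X ^ n) =
          ∫ s, (((m + Real.sqrt v * s) ^ n : ℝ) : ℂ) ∂wignerLaw := by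
        show ∫ s, _ ∂wignerLaw = _
        simp
      rw [e, integral_complex_ofReal] at key
      simpa using key
    · rw [LinearMap.sub_apply, ← hv, wignerFunctional_semicirclePoly, hv]
      split_ifs with hk
      · simp [hk, semicirclePoly, h1]
      · simpa using h k hk

/-! ### Non-crossing partitions into singletons and pairs -/

/-- `π` is a non-crossing partition of the points below `t` and the points in `s` into singletons
and pairs, each of which meets the points below `t`. -/
structure IsNCPartial {n : ℕ} (t : ℕ) (s : List (Fin n)) (π : Finset (Finset (Fin n))) : Prop where
  cover : ∀ x : Fin n, (x < t ∨ x ∈ s) → ∃ B ∈ π, x ∈ B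
  sub : ∀ B ∈ π, ∀ x ∈ B, x < t ∨ x ∈ s
  card : ∀ B ∈ π, B.card = 1 ∨ B.card = 2
  disj : ∀ B ∈ π, ∀ C ∈ π, ∀ x ∈ B, x ∈ C → B = C
  noncrossing : ∀ B ∈ π, ∀ C ∈ π, B ≠ C → ∀ i₁ ∈ B, ∀ j₁ ∈ C, ∀ i₂ ∈ B, ∀ j₂ ∈ C,
    i₁ < j₁ → j₁ < i₂ → ¬ i₂ < j₂
  meets : ∀ B ∈ π, ∃ x ∈ B, x.val < t

section Combinatorics

variable {n : ℕ}

theorem IsNCPartial.erase_singleton {t : Fin n} {s : List (Fin n)} {π : Finset (Finset (Fin n))}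
    (hs : ∀ b ∈ s, t < b) (h : IsNCPartial (t + 1) s π) (ht : {t} ∈ π) :
    IsNCPartial t s (π.erase {t}) where
  cover x hx := by
    obtain ⟨B, hB, hxB⟩ := h.cover x (hx.imp_left fun h => by omega)
    refine ⟨B, Finset.mem_erase.2 ⟨?_, hB⟩, hxB⟩
    rintro rfl
    rw [Finset.mem_singleton] at hxB
    subst hxB
    rcases hx with hx | hx
    · omega
    · exact lt_irrefl _ (hs _ hx)
  sub B hB x hx := by
    obtain ⟨hBt, hBπ⟩ := Finset.mem_erase.1 hB
    have hxt : x ≠ t := by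
      rintro rfl
      exact hBt (h.disj B hBπ _ ht _ hx (by simp))
    have : (x : ℕ) ≠ t := fun e => hxt (Fin.ext e)
    exact (h.sub B hBπ x hx).imp_left fun h => by omega
  card B hB := h.card B (Finset.mem_of_mem_erase hB)
  disj B hB C hC := h.disj B (Finset.mem_of_mem_erase hB) C (Finset.mem_of_mem_erase hC)
  noncrossing B hB C hC :=
    h.noncrossing B (Finset.mem_of_mem_erase hB) C (Finset.mem_of_mem_erase hC)
  meets B hB := by
    obtain ⟨hBt, hBπ⟩ := Finset.mem_erase.1 hB
    obtain ⟨x, hx, hxt⟩ := h.meets B hBπ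
    refine ⟨x, hx, ?_⟩
    have : (x : ℕ) ≠ t := fun e => by
      obtain rfl : x = t := Fin.ext e
      exact hBt (h.disj B hBπ _ ht _ hx (by simp))
    omega

theorem IsNCPartial.of_erase_singleton {t : Fin n} {s : List (Fin n)}
    {π : Finset (Finset (Fin n))} (hs : ∀ b ∈ s, t < b) (ht : {t} ∈ π)
    (h : IsNCPartial t s (π.erase {t})) : IsNCPartial (t + 1) s π := by
  have hmem : ∀ B ∈ π, B = {t} ∨ B ∈ π.erase {t} := fun B hB => by
    by_cases hBt : B = {t}
    · exact Or.inl hBt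
    · exact Or.inr (Finset.mem_erase.2 ⟨hBt, hB⟩)
  have hnot : ∀ B ∈ π.erase {t}, t ∉ B := fun B hB htB => by
    rcases h.sub B hB t htB with h' | h'
    · omega
    · exact lt_irrefl _ (hs _ h')
  refine ⟨fun x hx => ?_, fun B hB x hx => ?_, fun B hB => ?_, fun B hB C hC x hxB hxC => ?_,
    fun B hB C hC hBC => ?_, fun B hB => ?_⟩
  · by_cases hxt : x = t
    · exact ⟨{t}, ht, by simp [hxt]⟩
    · have : (x : ℕ) ≠ t := fun e => hxt (Fin.ext e)
      obtain ⟨B, hB, hxB⟩ := h.cover x (hx.imp_left fun h => by omega)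
      exact ⟨B, Finset.mem_of_mem_erase hB, hxB⟩
  · rcases hmem B hB with rfl | hB
    · rw [Finset.mem_singleton] at hx
      subst hx
      omega
    · exact (h.sub B hB x hx).imp_left fun h => by omega
  · rcases hmem B hB with rfl | hB
    · simp
    · exact h.card B hB
  · rcases hmem B hB with rfl | hB' <;> rcases hmem C hC with rfl | hC'
    · rfl
    · rw [Finset.mem_singleton] at hxB
      exact absurd (hxB ▸ hxC) (hnot C hC')
    · rw [Finset.mem_singleton] at hxC
      exact absurd (hxC ▸ hxB) (hnot B hB')
    · exact h.disj B hB' C hC' x hxB hxC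
  · rcases hmem B hB with rfl | hB' <;> rcases hmem C hC with rfl | hC'
    · exact absurd rfl hBC
    · simp only [Finset.mem_singleton]
      rintro _ rfl j₁ hj₁ _ rfl j₂ hj₂ h1 h2
      exact absurd (h1.trans h2) (lt_irrefl _)
    · simp only [Finset.mem_singleton]
      rintro _ hi₁ _ rfl _ hi₂ _ rfl h1 h2 h3
      exact absurd (h3.trans h2) (lt_irrefl _)
    · exact h.noncrossing B hB' C hC' hBC
  · rcases hmem B hB with rfl | hB
    · exact ⟨t, by simp, by simp⟩
    · obtain ⟨x, hx, hxt⟩ := h.meets B hB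
      exact ⟨x, hx, by omega⟩

theorem IsNCPartial.erase_pair {t b : Fin n} {s : List (Fin n)} {π : Finset (Finset (Fin n))}
    (hs : ∀ x ∈ b :: s, t < x) (hbs : b ∉ s) (h : IsNCPartial (t + 1) (b :: s) π)
    (ht : {t, b} ∈ π) : IsNCPartial t s (π.erase {t, b}) where
  cover x hx := by
    obtain ⟨B, hB, hxB⟩ := h.cover x (hx.imp (fun h => by omega) (List.mem_cons_of_mem _))
    refine ⟨B, Finset.mem_erase.2 ⟨?_, hB⟩, hxB⟩
    rintro rfl
    rw [Finset.mem_insert, Finset.mem_singleton] at hxB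
    have htb := hs b (by simp)
    rcases hxB with rfl | rfl
    · rcases hx with hx | hx
      · omega
      · exact lt_irrefl _ (hs _ (List.mem_cons_of_mem _ hx))
    · rcases hx with hx | hx
      · omega
      · exact hbs hx
  sub B hB x hx := by
    obtain ⟨hBt, hBπ⟩ := Finset.mem_erase.1 hB
    have hxt : x ≠ t := by
      rintro rfl
      exact hBt (h.disj B hBπ _ ht _ hx (by simp))
    have hxb : x ≠ b := by
      rintro rfl
      exact hBt (h.disj B hBπ _ ht _ hx (by simp))
    have h' := h.sub B hBπ x hx
    rw [List.mem_cons] at h'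
    have : (x : ℕ) ≠ t := fun e => hxt (Fin.ext e)
    rcases h' with h' | h' | h'
    · omega
    · exact absurd h' hxb
    · exact Or.inr h'
  card B hB := h.card B (Finset.mem_of_mem_erase hB)
  disj B hB C hC := h.disj B (Finset.mem_of_mem_erase hB) C (Finset.mem_of_mem_erase hC)
  noncrossing B hB C hC :=
    h.noncrossing B (Finset.mem_of_mem_erase hB) C (Finset.mem_of_mem_erase hC)
  meets B hB := by
    obtain ⟨hBt, hBπ⟩ := Finset.mem_erase.1 hB
    obtain ⟨x, hx, hxt⟩ := h.meets B hBπ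
    refine ⟨x, hx, ?_⟩
    have : (x : ℕ) ≠ t := fun e => by
      obtain rfl : x = t := Fin.ext e
      exact hBt (h.disj B hBπ _ ht _ hx (by simp))
    omega

theorem IsNCPartial.of_erase_pair {t b : Fin n} {s : List (Fin n)}
    {π : Finset (Finset (Fin n))} (htb : t < b) (hs : ∀ x ∈ s, b < x) (ht : {t, b} ∈ π)
    (h : IsNCPartial t s (π.erase {t, b})) : IsNCPartial (t + 1) (b :: s) π := by
  have hmem : ∀ B ∈ π, B = {t, b} ∨ B ∈ π.erase {t, b} := fun B hB => by
    by_cases hBt : B = {t, b}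
    · exact Or.inl hBt
    · exact Or.inr (Finset.mem_erase.2 ⟨hBt, hB⟩)
  have hout : ∀ B ∈ π.erase {t, b}, ∀ x ∈ B, x < t ∨ b < x := fun B hB x hx => by
    rcases h.sub B hB x hx with h' | h'
    · exact Or.inl h'
    · exact Or.inr (hs _ h')
  refine ⟨fun x hx => ?_, fun B hB x hx => ?_, fun B hB => ?_, fun B hB C hC x hxB hxC => ?_,
    fun B hB C hC hBC => ?_, fun B hB => ?_⟩
  · by_cases hxt : x = t
    · exact ⟨{t, b}, ht, by simp [hxt]⟩
    · by_cases hxb : x = b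
      · exact ⟨{t, b}, ht, by simp [hxb]⟩
      have : (x : ℕ) ≠ t := fun e => hxt (Fin.ext e)
      rw [List.mem_cons] at hx
      obtain ⟨B, hB, hxB⟩ := h.cover x (by
        rcases hx with hx | hx | hx
        · omega
        · exact absurd hx hxb
        · exact Or.inr hx)
      exact ⟨B, Finset.mem_of_mem_erase hB, hxB⟩
  · rcases hmem B hB with rfl | hB
    · rw [Finset.mem_insert, Finset.mem_singleton] at hx
      rcases hx with rfl | rfl
      · left
        omega
      · right
        simp
    · rcases h.sub B hB x hx with h' | h'
      · left
        omega
      · exact Or.inr (List.mem_cons_of_mem _ h')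
  · rcases hmem B hB with rfl | hB
    · exact Or.inr (Finset.card_pair htb.ne)
    · exact h.card B hB
  · rcases hmem B hB with rfl | hB' <;> rcases hmem C hC with rfl | hC'
    · rfl
    · have := hout C hC' x hxC
      simp only [Finset.mem_insert, Finset.mem_singleton] at hxB
      omega
    · have := hout B hB' x hxB
      simp only [Finset.mem_insert, Finset.mem_singleton] at hxC
      omega
    · exact h.disj B hB' C hC' x hxB hxC
  · rcases hmem B hB with rfl | hB' <;> rcases hmem C hC with rfl | hC'
    · exact absurd rfl hBC
    · simp only [Finset.mem_insert, Finset.mem_singleton]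
      intro i₁ hi₁ j₁ hj₁ i₂ hi₂ j₂ hj₂ h1 h2 h3
      have := hout C hC' j₁ hj₁
      omega
    · simp only [Finset.mem_insert, Finset.mem_singleton]
      intro i₁ hi₁ j₁ hj₁ i₂ hi₂ j₂ hj₂ h1 h2 h3
      have := hout B hB' i₂ hi₂
      omega
    · exact h.noncrossing B hB' C hC' hBC
  · rcases hmem B hB with rfl | hB
    · exact ⟨t, by simp, by simp⟩
    · obtain ⟨x, hx, hxt⟩ := h.meets B hB
      exact ⟨x, hx, by omega⟩

theorem IsNCPartial.close {t : Fin n} {s : List (Fin n)} {π : Finset (Finset (Fin n))}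
    (h : IsNCPartial t (t :: s) π) : IsNCPartial (t + 1) s π where
  cover x hx := h.cover x (by
    rw [List.mem_cons]
    by_cases hxt : x = t
    · exact Or.inr (Or.inl hxt)
    · have : (x : ℕ) ≠ t := fun e => hxt (Fin.ext e)
      exact hx.imp (fun h => by omega) Or.inr)
  sub B hB x hx := by
    have h' := h.sub B hB x hx
    rw [List.mem_cons] at h'
    rcases h' with h' | rfl | h'
    · omega
    · omega
    · exact Or.inr h'
  card := h.card
  disj := h.disj
  noncrossing := h.noncrossing
  meets B hB := by
    obtain ⟨x, hx, hxt⟩ := h.meets B hB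
    exact ⟨x, hx, by omega⟩

/-- The partner of `t` lies below `t` or in `s`. In the latter case it is the head of `s`, since the
block of a smaller open point reaches below `t` and would cross. -/
theorem IsNCPartial.open_or {t : Fin n} {s : List (Fin n)} {π : Finset (Finset (Fin n))}
    (hs : ∀ b ∈ s, t < b) (hso : s.Pairwise (· < ·)) (h : IsNCPartial (t + 1) s π)
    (ht : {t} ∉ π) : IsNCPartial t (t :: s) π ∨ ∃ b s', s = b :: s' ∧ {t, b} ∈ π := by
  by_contra! hcon
  refine hcon.1 ⟨fun x hx => h.cover x ?_, fun B hB x hx => ?_, h.card, h.disj, h.noncrossing,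
    fun B hB => ?_⟩
  · rw [List.mem_cons] at hx
    rcases hx with hx | rfl | hx
    · omega
    · omega
    · exact Or.inr hx
  · rw [List.mem_cons]
    by_cases hxt : x = t
    · exact Or.inr (Or.inl hxt)
    · have : (x : ℕ) ≠ t := fun e => hxt (Fin.ext e)
      exact (h.sub B hB x hx).imp (fun h => by omega) Or.inr
  · obtain ⟨x, hx, hxt⟩ := h.meets B hB
    by_cases hxt' : x = t
    swap
    · have : (x : ℕ) ≠ t := fun e => hxt' (Fin.ext e)
      exact ⟨x, hx, by omega⟩
    subst hxt'
    rcases h.card B hB with hc | hc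
    · obtain ⟨y, rfl⟩ := Finset.card_eq_one.1 hc
      rw [Finset.mem_singleton] at hx
      exact absurd (hx ▸ hB) ht
    obtain ⟨y, hyx, rfl⟩ : ∃ y, x ≠ y ∧ B = {x, y} := by
      obtain ⟨y, z, hyz, rfl⟩ := Finset.card_eq_two.1 hc
      rw [Finset.mem_insert, Finset.mem_singleton] at hx
      rcases hx with rfl | rfl
      · exact ⟨z, hyz, rfl⟩
      · exact ⟨y, hyz.symm, Finset.pair_comm _ _⟩
    have hyx' : (x : ℕ) ≠ y := fun e => hyx (Fin.ext e)
    rcases h.sub _ hB y (by simp) with hy | hy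
    · exact ⟨y, by simp, by omega⟩
    obtain ⟨b, s', rfl⟩ := List.exists_cons_of_ne_nil (List.ne_nil_of_mem hy)
    have hyb : y ≠ b := fun e => hcon.2 b s' rfl (e ▸ hB)
    have hby : b < y := by
      rw [List.mem_cons] at hy
      exact (List.pairwise_cons.1 hso).1 y (hy.resolve_left hyb)
    have hxb : x < b := hs b (by simp)
    obtain ⟨C, hC, hbC⟩ := h.cover b (by simp)
    obtain ⟨z, hz, hzt⟩ := h.meets C hC
    have hCB : C ≠ {x, y} := by
      rintro rfl
      simp [hyb.symm, hxb.ne'] at hbC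
    have hzx : z ≠ x := by
      rintro rfl
      exact hCB (h.disj _ hC _ hB _ hz (by simp))
    have hzx' : (z : ℕ) ≠ x := fun e => hzx (Fin.ext e)
    -- The crossing is `z < x < b < y`, with `z, b ∈ C` and the pair `{x, y}`.
    exact (h.noncrossing C hC _ hB hCB z hz x (by simp) b hbC y (by simp)
      (by rw [Fin.lt_def]; omega) hxb hby).elim

/-- The fate of the last point `t`: a singleton, an open point to be paired further left, or the
partner of the first open point. These match the three terms of `mul_wick`. -/
theorem IsNCPartial.step {t : Fin n} {s : List (Fin n)} {π : Finset (Finset (Fin n))}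
    (hs : ∀ b ∈ s, t < b) (hso : s.Pairwise (· < ·)) :
    IsNCPartial (t + 1) s π ↔ ({t} ∈ π ∧ IsNCPartial t s (π.erase {t})) ∨
      IsNCPartial t (t :: s) π ∨
      ∃ b s', s = b :: s' ∧ {t, b} ∈ π ∧ IsNCPartial t s' (π.erase {t, b}) := by
  constructor
  · intro h
    by_cases ht : {t} ∈ π
    · exact Or.inl ⟨ht, h.erase_singleton hs ht⟩
    · rcases h.open_or hs hso ht with h' | ⟨b, s', rfl, hb⟩
      · exact Or.inr (Or.inl h')
      · refine Or.inr (Or.inr ⟨b, s', rfl, hb, h.erase_pair hs (fun hbs => ?_) hb⟩)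
        exact lt_irrefl _ ((List.pairwise_cons.1 hso).1 b hbs)
  · rintro (⟨ht, h⟩ | h | ⟨b, s', rfl, hb, h⟩)
    · exact IsNCPartial.of_erase_singleton hs ht h
    · exact h.close
    · exact IsNCPartial.of_erase_pair (hs b (by simp)) (List.pairwise_cons.1 hso).1 hb h

/-! ### Recursion for weighted sums over partial non-crossing partitions -/

open Classical in
/-- The sum of the weights `∏ B ∈ π, k B` over all `π` with `IsNCPartial t s π`. -/
def ncSum (k : Finset (Fin n) → ℂ) (t : ℕ) (s : List (Fin n)) : ℂ :=
  ∑ π, if IsNCPartial t s π then ∏ B ∈ π, k B else 0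

open Classical in
theorem sum_insert_block (k : Finset (Fin n) → ℂ) (D : Finset (Fin n))
    (Q : Finset (Finset (Fin n)) → Prop) (hQ : ∀ π, Q π → D ∉ π) :
    (∑ π, if D ∈ π ∧ Q (π.erase D) then ∏ B ∈ π, k B else 0) =
      k D * ∑ π, if Q π then ∏ B ∈ π, k B else 0 := by
  rw [Finset.mul_sum, ← Finset.sum_filter]
  simp only [mul_ite, mul_zero]
  rw [← Finset.sum_filter]
  refine Finset.sum_bij' (fun π _ => π.erase D) (fun π _ => insert D π) ?_ ?_ ?_ ?_ ?_
  · intro π hπ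
    simpa using (Finset.mem_filter.1 hπ).2.2
  · intro π hπ
    have h := (Finset.mem_filter.1 hπ).2
    simpa [Finset.erase_insert (hQ π h)] using h
  · intro π hπ
    exact Finset.insert_erase (Finset.mem_filter.1 hπ).2.1
  · intro π hπ
    exact Finset.erase_insert (hQ π (Finset.mem_filter.1 hπ).2)
  · intro π hπ
    exact (Finset.mul_prod_erase _ _ (Finset.mem_filter.1 hπ).2.1).symm

/-- This makes the cases of `IsNCPartial.step` exclusive and block removal invertible. -/
theorem IsNCPartial.notMem_block {t : ℕ} {s : List (Fin n)} {π : Finset (Finset (Fin n))}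
    (h : IsNCPartial t s π) {D : Finset (Fin n)} (hD : ∀ x ∈ D, t ≤ x) : D ∉ π := fun hDπ => by
  obtain ⟨x, hx, hxt⟩ := h.meets D hDπ
  exact absurd hxt (not_lt.2 (hD x hx))

theorem ncSum_succ_nil (k : Finset (Fin n) → ℂ) (t : Fin n) :
    ncSum k (t + 1) [] = k {t} * ncSum k t [] + ncSum k t [t] := by
  classical
  unfold ncSum
  rw [← sum_insert_block k {t} _ fun π h => h.notMem_block (by simp), ← Finset.sum_add_distrib]
  refine Finset.sum_congr rfl fun π _ => ?_
  have h1 := IsNCPartial.step (t := t) (s := []) (π := π) (by simp) (by simp)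
  have h2 : IsNCPartial t [t] π → {t} ∉ π := fun h => h.notMem_block (by simp)
  simp only [reduceCtorEq, false_and, exists_false, or_false] at h1
  by_cases hA : {t} ∈ π ∧ IsNCPartial t [] (π.erase {t})
  · rw [if_pos (h1.2 (Or.inl hA)), if_pos hA, if_neg fun h => h2 h hA.1, add_zero]
  · rw [if_neg hA, zero_add]
    exact if_congr (h1.trans (or_iff_right hA)) rfl rfl

theorem ncSum_succ_cons (k : Finset (Fin n) → ℂ) (t b : Fin n) (s : List (Fin n))
    (hs : ∀ x ∈ b :: s, t < x) (hso : (b :: s).Pairwise (· < ·)) :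
    ncSum k (t + 1) (b :: s) =
      k {t} * ncSum k t (b :: s) + ncSum k t (t :: b :: s) + k {t, b} * ncSum k t s := by
  classical
  have htb : t < b := hs b (by simp)
  unfold ncSum
  have hD : ∀ x ∈ ({t, b} : Finset (Fin n)), (t : ℕ) ≤ x := by
    simp only [Finset.mem_insert, Finset.mem_singleton]
    rintro x (rfl | rfl)
    · exact le_rfl
    · exact htb.le
  rw [← sum_insert_block k {t} _ fun π h => h.notMem_block (by simp),
    ← sum_insert_block k {t, b} _ fun π h => h.notMem_block hD, ← Finset.sum_add_distrib,
    ← Finset.sum_add_distrib]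
  refine Finset.sum_congr rfl fun π _ => ?_
  have h1 := IsNCPartial.step (π := π) hs hso
  have h2 : IsNCPartial t (t :: b :: s) π → {t} ∉ π := fun h => h.notMem_block (by simp)
  have h3 : IsNCPartial t (t :: b :: s) π → {t, b} ∉ π := fun h => h.notMem_block hD
  have h4 : (∃ b' s', b :: s = b' :: s' ∧ {t, b'} ∈ π ∧ IsNCPartial t s' (π.erase {t, b'})) ↔
      {t, b} ∈ π ∧ IsNCPartial t s (π.erase {t, b}) := by
    constructor
    · rintro ⟨b', s', he, h⟩
      obtain ⟨rfl, rfl⟩ := List.cons.inj he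
      exact h
    · exact fun h => ⟨b, s, rfl, h⟩
  rw [h4] at h1
  by_cases hA : {t} ∈ π ∧ IsNCPartial t (b :: s) (π.erase {t})
  · have hP := h1.2 (Or.inl hA)
    have h5 : {t, b} ∉ π := fun h => by
      have := hP.disj _ h _ hA.1 t (by simp) (by simp)
      have hb : b ∈ ({t} : Finset (Fin n)) := this ▸ (by simp)
      exact htb.ne' (Finset.mem_singleton.1 hb)
    rw [if_pos hP, if_pos hA, if_neg fun h => h2 h hA.1, if_neg fun h => h5 h.1, add_zero,
      add_zero]
  · rw [if_neg hA, zero_add]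
    by_cases hC : {t, b} ∈ π ∧ IsNCPartial t s (π.erase {t, b})
    · rw [if_pos (h1.2 (Or.inr (Or.inr hC))), if_pos hC, if_neg fun h => h3 h hC.1, zero_add]
    · rw [if_neg hC, add_zero]
      exact if_congr ((h1.trans (or_iff_right hA)).trans (or_iff_left hC)) rfl rfl

theorem ncSum_zero_nil (k : Finset (Fin n) → ℂ) : ncSum k 0 [] = 1 := by
  classical
  unfold ncSum
  rw [Finset.sum_eq_single ∅]
  · rw [if_pos, Finset.prod_empty]
    constructor <;> simp
  · intro π _ hπ
    rw [if_neg]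
    intro h
    obtain ⟨B, hB⟩ := Finset.nonempty_iff_ne_empty.2 hπ
    obtain ⟨x, -, hx⟩ := h.meets B hB
    omega
  · simp

theorem ncSum_zero_cons (k : Finset (Fin n) → ℂ) (b : Fin n) (s : List (Fin n)) :
    ncSum k 0 (b :: s) = 0 := by
  classical
  unfold ncSum
  refine Finset.sum_eq_zero fun π _ => if_neg fun h => ?_
  obtain ⟨B, hB, -⟩ := h.cover b (by simp)
  obtain ⟨x, -, hx⟩ := h.meets B hB
  omega

/-- With all `n` points below the bound and none open, `IsNCPartial` describes the block sets of
non-crossing partitions into singletons and pairs; the other partitions have weight zero. -/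
theorem sum_NC_eq_ncSum (k : Finset (Fin n) → ℂ)
    (hk : ∀ B, B.card ≠ 1 → B.card ≠ 2 → k B = 0) :
    ∑ π ∈ NC n, ∏ B ∈ π.parts, k B = ncSum k n [] := by
  classical
  unfold ncSum
  rw [← Finset.sum_filter, ← Finset.sum_filter_of_ne (p := fun π => ∀ B ∈ π.parts,
    B.card = 1 ∨ B.card = 2)]
  · refine Finset.sum_bij (fun π _ => π.parts) ?_ ?_ ?_ ?_
    · intro π hπ
      obtain ⟨hNC, hc⟩ := Finset.mem_filter.1 hπ
      have hNC' : NonCrossing π := (Finset.mem_filter.1 hNC).2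
      refine Finset.mem_filter.2 ⟨Finset.mem_univ _, ?_, ?_, hc, ?_, ?_, ?_⟩
      · exact fun x _ => π.exists_mem (Finset.mem_univ x)
      · exact fun B _ x _ => Or.inl x.2
      · exact fun B hB C hC x hxB hxC => π.eq_of_mem_parts hB hC hxB hxC
      · exact fun B hB C hC hBC i₁ hi₁ j₁ hj₁ i₂ hi₂ j₂ hj₂ h1 h2 h3 =>
          hNC' B hB C hC hBC ⟨i₁, hi₁, j₁, hj₁, i₂, hi₂, j₂, hj₂, h1, h2, h3⟩
      · intro B hB
        obtain ⟨x, hx⟩ := π.nonempty_of_mem_parts hB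
        exact ⟨x, hx, x.2⟩
    · exact fun π _ π' _ h => Finpartition.ext h
    · intro P hP
      have h := (Finset.mem_filter.1 hP).2
      refine ⟨⟨P, ?_, ?_, ?_⟩, ?_, rfl⟩
      · rw [Finset.supIndep_iff_pairwiseDisjoint]
        exact fun B hB C hC hBC => Finset.disjoint_left.2 fun x hxB hxC =>
          hBC (h.disj B hB C hC x hxB hxC)
      · refine Finset.eq_univ_of_forall fun x => ?_
        obtain ⟨B, hB, hx⟩ := h.cover x (Or.inl x.2)
        exact Finset.mem_sup.2 ⟨B, hB, hx⟩
      · intro hbot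
        rcases h.card _ hbot with hc | hc <;> simp at hc
      · refine Finset.mem_filter.2 ⟨Finset.mem_filter.2 ⟨Finset.mem_univ _, ?_⟩, h.card⟩
        rintro B hB C hC hBC ⟨i₁, hi₁, j₁, hj₁, i₂, hi₂, j₂, hj₂, h1, h2, h3⟩
        exact h.noncrossing B hB C hC hBC i₁ hi₁ j₁ hj₁ i₂ hi₂ j₂ hj₂ h1 h2 h3
    · exact fun _ _ => rfl
  · intro π _ hne B hB
    by_contra! hc
    exact hne (Finset.prod_eq_zero hB (hk B hc.1 hc.2))

end Combinatorics

/-! ### Free cumulants of a semicircular system -/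

section Moments

variable {ι A : Type*} [Ring A] [Algebra ℂ A] {φ : A →ₗ[ℂ] ℂ} {X : ι → A} {m : ℂ}

/-- The Wick recursion solved for `X a * W(w)`: the letter contributes its mean, joins the word, or
contracts with the first letter. -/
theorem mul_wick (k : ι → ι → ℂ) (a : ι) (w : List ι) :
    X a * wick (fun i => X i - algebraMap ℂ A m) (fun i j => algebraMap ℂ A (k i j)) w =
      m • wick (fun i => X i - algebraMap ℂ A m) (fun i j => algebraMap ℂ A (k i j)) w +
      wick (fun i => X i - algebraMap ℂ A m) (fun i j => algebraMap ℂ A (k i j)) (a :: w) +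
      (match w with
        | [] => 0
        | b :: w => k a b •
            wick (fun i => X i - algebraMap ℂ A m) (fun i j => algebraMap ℂ A (k i j)) w) := by
  cases w with
  | nil => simp [Algebra.algebraMap_eq_smul_one]
  | cons b w =>
    simp only [wick_cons_cons, sub_mul, Algebra.smul_def]
    abel

/-- Both sides obey the same recursion in `t`: the rightmost remaining factor is absorbed into the
Wick word, whose letters are the open points. At `t = 0` a nonempty Wick word has expectation zero,
and open points cannot be matched. -/
theorem apply_prod_mul_wick_eq_ncSum (h1 : φ 1 = 1) (k : ι → ι → ℂ)
    (hW : ∀ l : List ι, l ≠ [] → φ (wick (fun i => X i - algebraMap ℂ A m)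
      (fun i j => algebraMap ℂ A (k i j)) l) = 0)
    {n : ℕ} (c : Fin n → ι) (κ : Finset (Fin n) → ℂ) (hκ₁ : ∀ t, κ {t} = m)
    (hκ₂ : ∀ t b, t ≠ b → κ {t, b} = k (c t) (c b))
    (t : ℕ) (ht : t ≤ n) (s : List (Fin n)) (hs : ∀ b ∈ s, t ≤ b) (hso : s.Pairwise (· < ·)) :
    φ (((List.ofFn fun j => X (c j)).take t).prod *
      wick (fun i => X i - algebraMap ℂ A m) (fun i j => algebraMap ℂ A (k i j)) (s.map c)) =
      ncSum κ t s := by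
  induction t generalizing s with
  | zero =>
    cases s with
    | nil => simp [ncSum_zero_nil, h1]
    | cons b s =>
      rw [ncSum_zero_cons, List.take_zero, List.prod_nil, one_mul, hW]
      simp
  | succ t ih =>
    have htn : t < (List.ofFn fun j => X (c j)).length := by simpa using ht
    have hs' : ∀ b ∈ s, (⟨t, ht⟩ : Fin n) < b := fun b hb => hs b hb
    have ih₁ := ih (Nat.le_of_succ_le ht) s (fun b hb => (hs' b hb).le) hso
    have ih₂ := ih (Nat.le_of_succ_le ht) (⟨t, ht⟩ :: s)
      (List.forall_mem_cons.2 ⟨le_rfl, fun b hb => (hs' b hb).le⟩) (List.pairwise_cons.2 ⟨hs', hso⟩)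
    rw [List.prod_take_succ _ _ htn, List.getElem_ofFn, mul_assoc, mul_wick, mul_add, mul_add,
      map_add, map_add, mul_smul_comm, map_smul, ih₁, ← List.map_cons (f := c) (a := ⟨t, ht⟩), ih₂]
    cases s with
    | nil =>
      have := ncSum_succ_nil κ ⟨t, ht⟩
      simp only [hκ₁] at this
      simp [this]
    | cons b s =>
      have := ncSum_succ_cons κ ⟨t, ht⟩ b s hs' hso
      simp only [hκ₁, hκ₂ _ _ (hs' b (by simp)).ne] at this
      rw [this, List.map_cons]
      simp only [mul_smul_comm, map_smul, smul_eq_mul]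
      rw [ih (Nat.le_of_succ_le ht) s (fun x hx => (hs' x (by simp [hx])).le)
        (List.pairwise_cons.1 hso).2]

/-- The free cumulants of a semicircular system with mean `m` and covariance `k`. -/
def semicircleCumulant (m : ℂ) (k : ι → ι → ℂ) : (n : ℕ) → (Fin n → ι) → ℂ
  | 1, _ => m
  | 2, c => k (c 0) (c 1)
  | _, _ => 0

theorem semicircleCumulant_eq_zero (k : ι → ι → ℂ) {n : ℕ} (h₁ : n ≠ 1) (h₂ : n ≠ 2)
    (c : Fin n → ι) : semicircleCumulant m k n c = 0 := by
  match n, c with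
  | 0, _ => rfl
  | n + 3, _ => rfl

theorem semicircleCumulant_of_card_eq_one (k : ι → ι → ℂ) {n : ℕ} (h : n = 1) (c : Fin n → ι) :
    semicircleCumulant m k n c = m := by
  subst h
  rfl

/-- Symmetry of `k` is needed because the block is enumerated increasingly, whereas `t` and `b` come
in either order. -/
theorem semicircleCumulant_pair {k : ι → ι → ℂ} (hk : ∀ i j, k i j = k j i) {n : ℕ} (c : Fin n → ι)
    (t b : Fin n) (htb : t ≠ b) {l : ℕ} (hl : ({t, b} : Finset (Fin n)).card = l) :
    semicircleCumulant m k l (fun j => c (({t, b} : Finset (Fin n)).orderEmbOfFin hl j)) =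
      k (c t) (c b) := by
  obtain rfl : l = 2 := by rw [← hl, Finset.card_pair htb]
  show k (c _) (c _) = _
  set e := ({t, b} : Finset (Fin n)).orderEmbOfFin hl
  have h0 : e 0 = t ∨ e 0 = b := by
    have := Finset.orderEmbOfFin_mem ({t, b} : Finset (Fin n)) hl 0
    rwa [Finset.mem_insert, Finset.mem_singleton] at this
  have h1 : e 1 = t ∨ e 1 = b := by
    have := Finset.orderEmbOfFin_mem ({t, b} : Finset (Fin n)) hl 1
    rwa [Finset.mem_insert, Finset.mem_singleton] at this
  have h01 : e 0 ≠ e 1 := fun h => by simpa using e.injective h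
  rcases h0 with h0 | h0 <;> rcases h1 with h1 | h1
  · exact absurd (h0.trans h1.symm) h01
  · rw [h0, h1]
  · rw [h0, h1, hk]
  · exact absurd (h0.trans h1.symm) h01

theorem eq_indiscrete_of_univ_mem {n : ℕ} {π : Finpartition (Finset.univ : Finset (Fin n))}
    (h : Finset.univ ∈ π.parts) : π.parts = {Finset.univ} := by
  refine Finset.eq_singleton_iff_unique_mem.2 ⟨h, fun C hC => ?_⟩
  obtain ⟨x, hx⟩ := π.nonempty_of_mem_parts hC
  exact π.eq_of_mem_parts hC h hx (Finset.mem_univ x)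

/-- The candidate cumulants satisfy the moment-cumulant formula, and that formula determines the
one-block term from the smaller cumulants. -/
theorem freeCumulant_eq_semicircleCumulant (h1 : φ 1 = 1) (k : ι → ι → ℂ)
    (hk : ∀ i j, k i j = k j i)
    (hW : ∀ l : List ι, l ≠ [] → φ (wick (fun i => X i - algebraMap ℂ A m)
      (fun i j => algebraMap ℂ A (k i j)) l) = 0)
    (n : ℕ) (hn : n ≠ 0) (c : Fin n → ι) :
    freeCumulant φ n (fun j => X (c j)) = semicircleCumulant m k n c := by
  induction n using Nat.strong_induction_on with
  | _ n ih =>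
  classical
  have : NeZero n := ⟨hn⟩
  set κ : Finset (Fin n) → ℂ := fun B =>
    semicircleCumulant m k B.card (fun j => c (B.orderEmbOfFin rfl j)) with hκ
  have hmom : φ (List.ofFn fun j => X (c j)).prod = ∑ π ∈ NC n, ∏ B ∈ π.parts, κ B := by
    rw [sum_NC_eq_ncSum κ fun B h h' => semicircleCumulant_eq_zero k h h' _]
    have := apply_prod_mul_wick_eq_ncSum h1 k hW c κ
      (fun t => semicircleCumulant_of_card_eq_one k (by simp) _)
      (fun t b htb => semicircleCumulant_pair hk c t b htb rfl) n le_rfl [] (by simp) (by simp)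
    rw [List.take_of_length_le (by simp)] at this
    simpa using this
  have hne : (Finset.univ : Finset (Fin n)) ≠ ⊥ := Finset.univ_nonempty.ne_empty
  set t : Finpartition (Finset.univ : Finset (Fin n)) := Finpartition.indiscrete hne with ht
  have htp : t.parts = {Finset.univ} := rfl
  have htm : t ∈ NC n := by
    simp only [NC, Finset.mem_filter, Finset.mem_univ, true_and]
    intro B hB C hC hBC
    rw [htp, Finset.mem_singleton] at hB hC
    exact absurd (hB.trans hC.symm) hBC
  have htop : κ Finset.univ = semicircleCumulant m k n c := by
    have hcast : ∀ (l : ℕ) (e : l = n) (f : Fin l → Fin n), StrictMono f →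
        semicircleCumulant m k l (fun j => c (f j)) = semicircleCumulant m k n c := by
      rintro l rfl f hf
      have : f = id := by
        have := Finset.orderEmbOfFin_unique (s := (Finset.univ : Finset (Fin l)))
          (Finset.card_fin l) (fun _ => Finset.mem_univ _) hf
        rw [this, Finset.orderEmbOfFin_unique (s := (Finset.univ : Finset (Fin l)))
          (Finset.card_fin l) (fun _ => Finset.mem_univ _) strictMono_id]
      rw [this]
      rfl
    exact hcast _ (by simp) _ (OrderEmbedding.strictMono _)
  rw [freeCumulant, hmom, ← Finset.add_sum_erase _ _ htm, ← Finset.add_sum_erase (NC n) _ htm, htp,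
    Finset.prod_singleton, Finset.prod_singleton, dif_neg (by simp), zero_add, htop,
    add_sub_assoc, add_eq_left, sub_eq_zero]
  refine Finset.sum_congr rfl fun π hπ => Finset.prod_congr rfl fun B hB => ?_
  have hBn : B.card < n := by
    refine lt_of_le_of_ne (by simpa using Finset.card_le_univ B) fun hc => ?_
    obtain rfl : B = Finset.univ := by
      rw [← Finset.card_eq_iff_eq_univ, hc, Fintype.card_fin]
    exact (Finset.mem_erase.1 hπ).1 (Finpartition.ext ((eq_indiscrete_of_univ_mem hB).trans htp.symm))
  rw [dif_pos hBn]
  exact (ih _ hBn (Finset.card_ne_zero.2 (π.nonempty_of_mem_parts hB)) _).symm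

end Moments

/-! ### Positivity on self-adjoint elements -/

section States

variable {A : Type*} [Ring A] [StarRing A] [Algebra ℂ A] {φ : A →ₗ[ℂ] ℂ}

theorem IsNCPS.apply_mul_self_nonneg (hφ : IsNCPS φ) {a : A} (ha : IsSelfAdjoint a) :
    0 ≤ φ (a * a) := by
  simpa [ha.star_eq] using hφ.nonneg a

/-- Both `φ (a²)` and `φ ((a + 1)²)` are real, and they differ by `2 φ a + 1`. -/
theorem IsNCPS.exists_real_eq (hφ : IsNCPS φ) {a : A} (ha : IsSelfAdjoint a) :
    ∃ m : ℝ, φ a = m := by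
  refine ⟨(φ a).re, Complex.ext rfl ?_⟩
  have h1 := (Complex.nonneg_iff.1 (hφ.apply_mul_self_nonneg ha)).2
  have h2 := (Complex.nonneg_iff.1 (hφ.apply_mul_self_nonneg (ha.add (IsSelfAdjoint.one A)))).2
  rw [add_mul, mul_add, mul_add, one_mul, mul_one, mul_one, map_add, map_add, map_add,
    hφ.map_one] at h2
  simp only [Complex.add_im, Complex.one_im, Complex.ofReal_im] at h2 ⊢
  linarith

end States

end

/-! ### The main theorem -/

theorem mainTheorem1 {d : ℕ}
    {A : Type*} [Ring A] [StarRing A] [Algebra ℂ A] [StarModule ℂ A]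
    (φ : A →ₗ[ℂ] ℂ) (hφ : IsNCPS φ)
    {B : Type*} [Ring B] [StarRing B] [Algebra ℂ B] [StarModule ℂ B]
    {H : Type*} [NormedAddCommGroup H] [InnerProductSpace ℂ H] [CompleteSpace H]
    (ρ : B →⋆ₐ[ℂ] (H →L[ℂ] H)) (hρ : Function.Injective ρ)
    (β : PolO d →⋆ₐ[ℂ] B) (hβ : Function.Surjective β) (hH : ¬ ContainedInH β)
    (X : Fin d → A) (hX : ∀ i, IsSelfAdjoint (X i))
    (hfree : FreeFamily φ X)
    (hid : ∀ (i i' : Fin d) (n : ℕ), φ (X i ^ n) = φ (X i' ^ n))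
    (hY : FreeFamilyOver φ (rotate β X)) :
    (∃ (m : ℝ) (v : ℝ≥0), ∀ i, HasDistribution φ (X i) (semicircleLaw m v)) ∧
      ∀ n : ℕ, 3 ≤ n → ∀ i : Fin n → Fin d, freeCumulant φ n (fun k => X (i k)) = 0 := by
  -- For `d = 0` the row relations are vacuous, so the quantum subset would lie in `H_d^+`.
  obtain ⟨i₀⟩ : Nonempty (Fin d) := by
    by_contra hd
    rw [not_nonempty_iff] at hd
    exact hH (containedInH_of_row_zero β fun i => hd.elim i)
  obtain ⟨m, hm₀⟩ := hφ.exists_real_eq (hX i₀)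
  have hm : ∀ i, φ (X i) = m := fun i => by simpa [hm₀] using hid i i₀ 1
  have hsa : ∀ i, IsSelfAdjoint (X i - algebraMap ℂ A m) := fun i => by
    refine (hX i).sub ?_
    rw [IsSelfAdjoint, ← algebraMap_star_comm]
    simp
  set k : Fin d → Fin d → ℂ := fun i j =>
    φ ((X i - algebraMap ℂ A m) * (X j - algebraMap ℂ A m)) with hk
  have hW := hY.wick_eq_zero hH hφ.map_one hfree hid hm
  have hkd : ∀ i j, i ≠ j → k i j = 0 := fun i j => hfree.apply_mul_eq_zero hφ.map_one hm
  -- No traciality of `φ` is needed: off the diagonal both sides vanish.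
  have hks : ∀ i j, k i j = k j i := fun i j => by
    by_cases hij : i = j
    · rw [hij]
    · rw [hkd i j hij, hkd j i (Ne.symm hij)]
  refine ⟨⟨m, (k i₀ i₀).re.toNNReal,
    fun i => hasDistribution_semicircleLaw φ hφ.map_one _ (hX i) _ _ fun n hn => ?_⟩, ?_⟩
  · have hv : (((k i₀ i₀).re : ℝ) : ℂ) = k i₀ i₀ :=
      Complex.ext rfl (Complex.nonneg_iff.1 (hφ.apply_mul_self_nonneg (hsa i₀))).2
    have := hW (List.replicate n i₀) (by simpa using hn)
    rw [wick_replicate, apply_aeval_eq hid i₀ i] at this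
    rw [Real.coe_toNNReal _ (Complex.nonneg_iff.1 (hφ.apply_mul_self_nonneg (hsa i₀))).1, hv]
    exact this
  · intro n hn c
    rw [freeCumulant_eq_semicircleCumulant hφ.map_one k hks hW n (by omega) c,
      semicircleCumulant_eq_zero k (by omega) (by omega)]
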